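/- Model ($\mathrm{KT}_1$ LOCAL). The network is an undirected graph $G=(V,E)$ with $n=|V|\ge 2$ nodes carrying arbitrary distinct identifiers from $\mathbb{N}$. All nodes run the same algorithm in synchronous rounds; in each round a node may send one message of unbounded size to each of its neighbors, receives the messages sent to it in that round, and performs arbitrary local computation. Initially a node knows only $n$, $\kappa$, $W$, its own identifier, the identifiers of its neighbors, and its own random seed, which is independent of the seeds of the other nodes. A node terminates when it produces its output, and then sends no further messages. The round complexity is the number of rounds until all nodes have terminated; the message complexity is the total number of messages sent. Let $\kappa, W\ge 1$ be integers. A sparse $(\kappa,W)$-neighborhood cover of $G$ is a finite collection $\mathcal{C}$ of rooted trees (clusters) that are subgraphs of $G$ such that: every $\tau\in\mathcal{C}$ has depth $O(\kappa W)$; every vertex is contained in $O(\kappa\, n^{1/\kappa}\log n)$ of the trees; and for every vertex $v$ some $\tau\in\mathcal{C}$ contains all vertices at distance at most $W$ from $v$ in $G$. It is constructed when every node outputs the names of the clusters containing it and, for each of these, the identifiers of its parent (none, if it is the root) and of its children in the cluster tree. Lemma. For every constant $c\in\mathbb{N}$ there is a randomized distributed (Monte Carlo) algorithm in the $\mathrm{KT}_1$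 LOCAL model that, for all $n$, $\kappa$, $W$ and $G$ as above, always terminates within $O(\kappa^3W^2)$ rounds and, with probability at least $1-n^{-c}$, constructs a sparse $(\kappa,W)$-neighborhood cover of $G$ and sends $O(n\cdot\kappa\cdot n^{1/\kappa}\log n\cdot\kappa W)$ messages in total. All the hidden constants depend only on $c$. -/

import Mathlib

open MeasureTheory
open scoped ENNReal unitInterval

universe u

noncomputable section

/-! ### Sparse neighborhood covers -/

/-- A cluster of a graph `G`: a rooted tree which is a subgraph of `G`. -/
structure Cluster {V : Type u} (G : SimpleGraph V) where
  tree : G.Subgraph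
  isTree : tree.coe.IsTree
  root : tree.verts

namespace Cluster

variable {V : Type u} {G : SimpleGraph V}

/-- The depth of a (finite) cluster: the largest distance, in the tree, from the root. -/
def depth (τ : Cluster G) : ℕ :=
  ⨆ v : τ.tree.verts, τ.tree.coe.dist τ.root v

/-- `p` is the parent of `v` in the rooted tree `τ`: they are adjacent in the tree, and `v` is
one step further away from the root than `p`. -/
def IsParent (τ : Cluster G) (p v : V) : Prop :=
  ∃ (hp : p ∈ τ.tree.verts) (hv : v ∈ τ.tree.verts), τ.tree.Adj p v ∧
    τ.tree.coe.dist τ.root ⟨v, hv⟩ = τ.tree.coe.dist τ.root ⟨p, hp⟩ + 1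

end Cluster

/-- The finite family `𝒞` of clusters of `G` is a sparse `(κ, W)`-neighborhood cover, where the
constant hidden in the asymptotic bounds on depth and sparsity is `C`. -/
structure IsSparseNeighborhoodCover {V : Type u} [Fintype V] {G : SimpleGraph V}
    {ι : Type} [Fintype ι] (C : ℝ) (κ W : ℕ) (𝒞 : ι → Cluster G) : Prop where
  depth_le : ∀ i, ((𝒞 i).depth : ℝ) ≤ C * (W * κ)
  sparsity : ∀ v : V, ({i | v ∈ (𝒞 i).tree.verts}.ncard : ℝ) ≤
    C * (κ * (Fintype.card V : ℝ) ^ (1 / (κ : ℝ)) * Real.log (Fintype.card V))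
  neighborhood : ∀ v : V, ∃ i, ∀ w : V, G.edist v w ≤ W → w ∈ (𝒞 i).tree.verts

/-! ### The synchronous `KT₁` LOCAL model -/

/-- A communication network: an undirected graph whose nodes carry distinct identifiers. -/
structure Network (V : Type u) where
  graph : SimpleGraph V
  ident : V ↪ ℕ

/-- What a node knows at the beginning: the number `n` of nodes and the parameters `κ` and `W`,
its own identifier, the identifiers of its neighbors, and its private random seed, a uniformly
random number in `[0, 1]` (whose binary digits are an infinite sequence of fair coin flips). -/
structure LocalInput where
  n : ℕ
  κ : ℕ
  W : ℕ
  ident : ℕ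
  nbrs : Finset ℕ
  seed : I

/-- What a node produces: the (names of the) clusters that it belongs to and, for each of them, the
identifiers of its parent (`none` at the root) and of its children in the cluster tree. -/
structure LocalOutput where
  clusters : Finset ℕ
  parent : ℕ → Option ℕ
  children : ℕ → Finset ℕ

/-- A distributed algorithm: all nodes run the same code. Messages are elements of an arbitrary
type, so their size is not restricted, and local computation is arbitrary. -/
structure DistAlgorithm where
  State : Type
  Msg : Type
  /-- the initial state -/
  start : LocalInput → State
  /-- the message (if any) sent in the current round to the neighbor with the given identifier -/
  send : State → ℕ → Option Msg
  /-- the new state, from the messages received, indexed by the identifiers of their senders -/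
  update : State → (ℕ → Option Msg) → State
  /-- the output; a node that produces one has terminated -/
  output : State → Option LocalOutput

namespace DistAlgorithm

variable {V : Type u} [Fintype V]

/-- The message actually sent: a node that has terminated sends nothing. -/
def emit (A : DistAlgorithm) (s : A.State) (x : ℕ) : Option A.Msg :=
  if (A.output s).isSome then none else A.send s x

open Classical in
/-- The messages received by `v` in a round at whose beginning the nodes are in the states `s`:
the identifier `x` is mapped to the message of the neighbor of `v` whose identifier is `x`. -/
def inbox (A : DistAlgorithm) (N : Network V) (s : V → A.State) (v : V) (x : ℕ) : Option A.Msg :=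
  if h : ∃ w, N.graph.Adj v w ∧ N.ident w = x then A.emit (s h.choose) (N.ident v) else none

open Classical in
/-- The initial knowledge of `v` in the `KT₁` model, when its private random seed is `r`. -/
def localInput (N : Network V) (κ W : ℕ) (r : I) (v : V) : LocalInput where
  n := Fintype.card V
  κ := κ
  W := W
  ident := N.ident v
  nbrs := (Finset.univ.filter fun w => N.graph.Adj v w).image N.ident
  seed := r

/-- The states of the nodes after `t` rounds, when the random seeds are `ω`. A node that has
terminated does not change its state. -/
def run (A : DistAlgorithm) (N : Network V) (κ W : ℕ) (ω : V → I) : ℕ → V → A.State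
  | 0 => fun v => A.start (localInput N κ W (ω v) v)
  | t + 1 => fun v =>
      if (A.output (A.run N κ W ω t v)).isSome then A.run N κ W ω t v
      else A.update (A.run N κ W ω t v) (A.inbox N (A.run N κ W ω t) v)

open Classical in
/-- The number of messages sent by all nodes in the round that starts in the states `s`. -/
def roundMessages (A : DistAlgorithm) (N : Network V) (s : V → A.State) : ℕ :=
  Finset.card {p : V × V | N.graph.Adj p.1 p.2 ∧ (A.emit (s p.1) (N.ident p.2)).isSome}

/-- The total number of messages sent by all nodes in the first `T` rounds. -/
def messages (A : DistAlgorithm) (N : Network V) (κ W : ℕ) (ω : V → I) (T : ℕ) : ℕ :=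
  ∑ t ∈ Finset.range T, A.roundMessages N (A.run N κ W ω t)

/-- All nodes have terminated within `T` rounds. -/
def TerminatesBy (A : DistAlgorithm) (N : Network V) (κ W : ℕ) (ω : V → I) (T : ℕ) : Prop :=
  ∀ v, (A.output (A.run N κ W ω T v)).isSome

end DistAlgorithm

/-- The outputs `out` of the nodes are a distributed representation of the family `𝒞` of clusters,
which are named by the elements of `L`: every node knows the clusters that it belongs to, and its
parent and its children in each of their trees. -/
structure Represents {V : Type u} (N : Network V) (out : V → LocalOutput)
    (L : Finset ℕ) (𝒞 : L → Cluster N.graph) : Prop where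
  mem_clusters : ∀ v l, l ∈ (out v).clusters ↔ ∃ h : l ∈ L, v ∈ (𝒞 ⟨l, h⟩).tree.verts
  parent_eq : ∀ (i : L) (v : V), v ∈ (𝒞 i).tree.verts → ∀ x,
    (out v).parent i = some x ↔ ∃ p, N.ident p = x ∧ (𝒞 i).IsParent p v
  mem_children : ∀ (i : L) (v : V), v ∈ (𝒞 i).tree.verts → ∀ x,
    x ∈ (out v).children i ↔ ∃ w, N.ident w = x ∧ (𝒞 i).IsParent v w

/-- After `T` rounds all nodes have terminated, and their outputs represent a sparse
`(κ, W)`-neighborhood cover of the network (with constant `C`). -/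
def DistAlgorithm.ConstructsCover {V : Type u} [Fintype V] (A : DistAlgorithm) (N : Network V)
    (C : ℝ) (κ W : ℕ) (ω : V → I) (T : ℕ) : Prop :=
  ∃ (out : V → LocalOutput) (L : Finset ℕ) (𝒞 : L → Cluster N.graph),
    (∀ v, A.output (A.run N κ W ω T v) = some (out v)) ∧
    Represents N out L 𝒞 ∧ IsSparseNeighborhoodCover C κ W 𝒞

end

/-!
Every node `u` emits a wave, after a random delay that is determined by its seed. A node joins the
cluster of `u` if the wave of `u` reaches it at most `2 * W` steps after the first wave that reaches
it. If `u` is the node whose wave reaches `v` first, then the whole ball of radius `W` around `v`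
joins the cluster of `u`. The delays are geometrically distributed (up to a cap), so by the lack of
memory it is unlikely that many waves reach a node soon after the first one; hence the clusters are
sparse.

The waves move one step per phase. Within a phase, the nodes of each cluster gather in the root and
then broadcast, along the cluster tree, all they know about the cluster. Therefore all of them know
which of their neighbors have already been invited to the cluster and by whom, so that every node is
invited to every cluster at most once, and the number of messages is governed by the number of pairs
of a node and a nearby cluster rather than by the number of edges.
-/

noncomputable section

/-! ### Trees given by parent maps -/

/-- The edges of `H` join the vertices other than the root `r` to their parents `par v`, and
`dep v` is the number of steps from `v` to the root. -/
structure IsParentMap {S : Type*} (H : SimpleGraph S) (r : S) (par : S → S) (dep : S → ℕ) :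
    Prop where
  dep_root : dep r = 0
  dep_par : ∀ v, v ≠ r → dep (par v) + 1 = dep v
  adj_iff : ∀ x y, H.Adj x y ↔ (x ≠ r ∧ par x = y) ∨ (y ≠ r ∧ par y = x)

namespace IsParentMap

variable {S : Type*} {H : SimpleGraph S} {r : S} {par : S → S} {dep : S → ℕ}

theorem adj_par (h : IsParentMap H r par dep) {v : S} (hv : v ≠ r) : H.Adj (par v) v :=
  (h.adj_iff _ _).2 (.inr ⟨hv, rfl⟩)

theorem exists_walk (h : IsParentMap H r par dep) (v : S) :
    ∃ p : H.Walk r v, p.length = dep v := by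
  induction hd : dep v generalizing v with
  | zero =>
    obtain rfl : v = r := by
      by_contra hv
      have := h.dep_par v hv
      omega
    exact ⟨.nil, rfl⟩
  | succ d ih =>
    have hv : v ≠ r := by
      rintro rfl
      have := h.dep_root
      omega
    obtain ⟨p, hp⟩ := ih (par v) (by have := h.dep_par v hv; omega)
    exact ⟨p.concat (h.adj_par hv), by rw [SimpleGraph.Walk.length_concat, hp]⟩

theorem connected (h : IsParentMap H r par dep) : H.Connected where
  preconnected x y :=
    (h.exists_walk x).choose.reachable.symm.trans (h.exists_walk y).choose.reachable
  nonempty := ⟨r⟩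

theorem dep_le_of_adj (h : IsParentMap H r par dep) {x y : S} (hxy : H.Adj x y) :
    dep y ≤ dep x + 1 := by
  rcases (h.adj_iff x y).1 hxy with ⟨hx, rfl⟩ | ⟨hy, rfl⟩
  · have := h.dep_par x hx
    omega
  · exact (h.dep_par y hy).ge

theorem dep_le_add_length (h : IsParentMap H r par dep) {x y : S} (p : H.Walk x y) :
    dep y ≤ dep x + p.length := by
  induction p with
  | nil => exact le_rfl
  | cons hadj p ih =>
    have := h.dep_le_of_adj hadj
    rw [SimpleGraph.Walk.length_cons]
    omega

theorem dist_root (h : IsParentMap H r par dep) (v : S) : H.dist r v = dep v := by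
  obtain ⟨p, hp⟩ := h.exists_walk v
  obtain ⟨p', hp'⟩ := h.connected.exists_walk_length_eq_dist r v
  refine le_antisymm (hp ▸ SimpleGraph.dist_le p) ?_
  have := h.dep_le_add_length p'
  rwa [h.dep_root, zero_add, hp'] at this

theorem card_edgeSet_add_one_le [Finite S] (h : IsParentMap H r par dep) :
    Nat.card H.edgeSet + 1 ≤ Nat.card S := by
  have hsurj : Function.Surjective fun v : ({r}ᶜ : Set S) =>
      (⟨s(par v, v), h.adj_par v.2⟩ : H.edgeSet) := by
    rintro ⟨⟨x, y⟩, hxy⟩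
    rcases (h.adj_iff x y).1 hxy with ⟨hx, rfl⟩ | ⟨hy, rfl⟩
    · exact ⟨⟨x, hx⟩, Subtype.ext Sym2.eq_swap⟩
    · exact ⟨⟨y, hy⟩, rfl⟩
  have hcard := Set.ncard_add_ncard_compl ({r} : Set S)
  rw [Set.ncard_singleton, ← Nat.card_coe_set_eq] at hcard
  have hle : Nat.card H.edgeSet ≤ Nat.card ({r}ᶜ : Set S) :=
    Nat.card_le_card_of_surjective _ hsurj
  omega

theorem isTree [Finite S] (h : IsParentMap H r par dep) : H.IsTree :=
  SimpleGraph.isTree_iff_connected_and_card.2 ⟨h.connected,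
    h.card_edgeSet_add_one_le.antisymm h.connected.card_vert_le_card_edgeSet_add_one⟩

end IsParentMap

/-! ### Distances with a default value -/

section DistOr

variable {V : Type*} {G : SimpleGraph V} {d : ℕ} {u v w : V}

open Classical in
/-- The distance from `u` to `w` in `G`, except that unreachable vertices are at distance `d`
(Mathlib's `SimpleGraph.dist` puts them at distance `0`). -/
def distOr (G : SimpleGraph V) (d : ℕ) (u w : V) : ℕ :=
  if G.Reachable u w then G.dist u w else d

theorem distOr_of_reachable (h : G.Reachable u w) : distOr G d u w = G.dist u w := if_pos h

theorem distOr_of_not_reachable (h : ¬ G.Reachable u w) : distOr G d u w = d := if_neg h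

theorem distOr_self : distOr G d u u = 0 := by
  rw [distOr_of_reachable .rfl, SimpleGraph.dist_self]

theorem eq_of_distOr_eq_zero (hd : d ≠ 0) (h : distOr G d u w = 0) : u = w := by
  by_cases hr : G.Reachable u w
  · rw [distOr_of_reachable hr] at h
    exact hr.dist_eq_zero_iff.1 h
  · rw [distOr_of_not_reachable hr] at h
    exact absurd h hd

theorem distOr_le_add_length (p : G.Walk v w) : distOr G d u w ≤ distOr G d u v + p.length := by
  by_cases hr : G.Reachable u v
  · rw [distOr_of_reachable hr, distOr_of_reachable (hr.trans p.reachable)]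
    obtain ⟨q, hq⟩ := hr.exists_walk_length_eq_dist
    have := SimpleGraph.dist_le (q.append p)
    rwa [SimpleGraph.Walk.length_append, hq] at this
  · rw [distOr_of_not_reachable hr,
      distOr_of_not_reachable fun h => hr (h.trans p.reachable.symm)]
    exact Nat.le_add_right _ _

theorem distOr_le_of_adj (h : G.Adj v w) : distOr G d u w ≤ distOr G d u v + 1 :=
  distOr_le_add_length h.toWalk

theorem distOr_le_of_edist_le {r : ℕ} (h : G.edist v w ≤ r) :
    distOr G d u w ≤ distOr G d u v + r := by
  obtain ⟨p, hp⟩ := SimpleGraph.exists_walk_of_edist_ne_top (ne_top_of_le_ne_top (by simp) h)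
  have hpr : p.length ≤ r := by exact_mod_cast hp ▸ h
  exact (distOr_le_add_length p).trans (by omega)

theorem exists_adj_distOr_add_one (h : distOr G d u w < d) (huw : u ≠ w) :
    ∃ x, G.Adj w x ∧ distOr G d u x + 1 = distOr G d u w := by
  have hr : G.Reachable u w := by
    by_contra hr
    exact h.ne (distOr_of_not_reachable hr)
  obtain ⟨p, hp⟩ := hr.exists_walk_length_eq_dist
  have hadj := p.adj_penultimate (SimpleGraph.Walk.not_nil_of_ne huw)
  refine ⟨p.penultimate, hadj.symm, (distOr_le_of_adj hadj).antisymm' ?_⟩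
  have hdrop := distOr_le_add_length (d := d) (u := u) p.dropLast
  have hlen := p.length_dropLast_add_one (SimpleGraph.Walk.not_nil_of_ne huw)
  rw [distOr_self] at hdrop
  rw [distOr_of_reachable hr]
  omega

end DistOr

/-! ### Probability -/

section Pi

variable {ι : Type*} [Fintype ι] {α : ι → Type*} [∀ i, MeasurableSpace (α i)]
  (μ : ∀ i, Measure (α i)) [∀ i, IsProbabilityMeasure (μ i)]

open Classical in
theorem measure_pi_univ_pi_ite (A : Finset ι) (S T : ∀ i, Set (α i)) :
    Measure.pi μ (Set.univ.pi fun i => if i ∈ A then S i else T i) =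
      (∏ i ∈ A, μ i (S i)) * ∏ i ∈ Aᶜ, μ i (T i) := by
  rw [Measure.pi_pi, ← Finset.prod_mul_prod_compl A]
  congr 1 <;> refine Finset.prod_congr rfl fun i hi => ?_
  · rw [if_pos hi]
  · rw [if_neg (Finset.mem_compl.1 hi)]

-- The event is covered by the boxes in which `A` is exactly the set of `i` with `ω i ∈ S i`.
theorem measure_pi_le_ncard_and_forall_notMem_le {S T : ∀ i, Set (α i)}
    (hS : ∀ i, MeasurableSet (S i)) {q : ℝ≥0∞} (hq : q ≤ 1)
    (hST : ∀ i, μ i (S i \ T i) ≤ q * μ i (S i)) (k : ℕ) :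
    Measure.pi μ {ω | k ≤ {i | ω i ∈ S i}.ncard ∧ ∀ i, ω i ∉ T i} ≤ q ^ k := by
  classical
  let box (A : Finset ι) : Set (∀ i, α i) :=
    Set.univ.pi fun i => if i ∈ A then S i \ T i else (S i)ᶜ
  have hcover : {ω | k ≤ {i | ω i ∈ S i}.ncard ∧ ∀ i, ω i ∉ T i} ⊆
      ⋃ A ∈ ({A | k ≤ A.card} : Finset (Finset ι)), box A := by
    rintro ω ⟨hk, hT⟩
    refine Set.mem_biUnion (x := ({i | ω i ∈ S i} : Finset ι)) ?_ fun i _ => ?_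
    · rw [← Finset.coe_filter_univ, Set.ncard_coe_finset] at hk
      simpa using hk
    · by_cases hi : ω i ∈ S i <;> simp [hi, hT i]
  have hbox (A : Finset ι) (hA : k ≤ A.card) : Measure.pi μ (box A) ≤
      q ^ k * ((∏ i ∈ A, μ i (S i)) * ∏ i ∈ Aᶜ, μ i (S i)ᶜ) := by
    calc Measure.pi μ (box A)
        = (∏ i ∈ A, μ i (S i \ T i)) * ∏ i ∈ Aᶜ, μ i (S i)ᶜ := measure_pi_univ_pi_ite μ A _ _
      _ ≤ (∏ i ∈ A, q * μ i (S i)) * ∏ i ∈ Aᶜ, μ i (S i)ᶜ := by gcongr with i; exact hST i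
      _ = q ^ A.card * ((∏ i ∈ A, μ i (S i)) * ∏ i ∈ Aᶜ, μ i (S i)ᶜ) := by
          rw [Finset.prod_mul_distrib, Finset.prod_const, mul_assoc]
      _ ≤ _ := by gcongr ?_ * _; exact pow_le_pow_right_of_le_one' hq hA
  calc Measure.pi μ {ω | k ≤ {i | ω i ∈ S i}.ncard ∧ ∀ i, ω i ∉ T i}
      ≤ ∑ A : Finset ι with k ≤ A.card, Measure.pi μ (box A) :=
        (measure_mono hcover).trans (measure_biUnion_finset_le _ _)
    _ ≤ ∑ A : Finset ι with k ≤ A.card,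
          q ^ k * ((∏ i ∈ A, μ i (S i)) * ∏ i ∈ Aᶜ, μ i (S i)ᶜ) :=
        Finset.sum_le_sum fun A hA => hbox A (Finset.mem_filter.1 hA).2
    _ ≤ ∑ A : Finset ι, q ^ k * ((∏ i ∈ A, μ i (S i)) * ∏ i ∈ Aᶜ, μ i (S i)ᶜ) :=
        Finset.sum_le_sum_of_subset (Finset.filter_subset _ _)
    _ = q ^ k * ∏ i, (μ i (S i) + μ i (S i)ᶜ) := by rw [← Finset.mul_sum, Fintype.prod_add]
    _ = q ^ k := by simp only [prob_add_prob_compl (hS _), Finset.prod_const_one, mul_one]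

end Pi

section GeometricShift

variable {V : Type*} [Fintype V] {q : ℝ}

/-- The number of times that `q` can be multiplied to `1` with the result staying at least `r`, but
at most `cap`. When `r` is uniformly distributed in `[0, 1]`, this has the geometric distribution
with ratio `q`, truncated at `cap`. -/
def geomShift (q : ℝ) (cap : ℕ) (r : ℝ) : ℕ :=
  open Classical in Nat.findGreatest (fun m => r ≤ q ^ m) cap

theorem geomShift_le (q : ℝ) (cap : ℕ) (r : ℝ) : geomShift q cap r ≤ cap :=
  Nat.findGreatest_le cap

theorem le_geomShift_iff (hq0 : 0 ≤ q) (hq1 : q ≤ 1) {cap : ℕ} {r : ℝ} (hr1 : r ≤ 1)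
    (hr : q ^ cap < r) (m : ℕ) : m ≤ geomShift q cap r ↔ r ≤ q ^ m := by
  classical
  refine ⟨fun hm => ?_, fun hm => Nat.le_findGreatest ?_ hm⟩
  · have hspec : r ≤ q ^ geomShift q cap r :=
      Nat.findGreatest_spec (P := fun m => r ≤ q ^ m) (Nat.zero_le cap) (by simpa using hr1)
    exact hspec.trans (pow_le_pow_of_le_one hq0 hq1 hm)
  · by_contra! hlt
    exact (hr.trans_le hm).not_ge (pow_le_pow_of_le_one hq0 hq1 hlt.le)

theorem volume_setOf_apply_le (v : V) (x : I) :
    (volume : Measure (V → I)) {ω | ω v ≤ x} = ENNReal.ofReal x := by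
  rw [← unitInterval.volume_Iic x]
  exact (measurePreserving_eval (fun _ : V => (volume : Measure I)) v).measure_preimage
    measurableSet_Iic.nullMeasurableSet

-- The geometric law is memoryless: a shift that is at least `D u - (a + s)` exceeds it by more
-- than `s` with probability `q ^ (s + 1)`.
theorem volume_many_le_none_le (hq0 : 0 ≤ q) (hq1 : q ≤ 1) (D : V → ℕ) (a s k : ℕ) :
    (volume : Measure (V → I))
      {ω | k ≤ {u | (ω u : ℝ) ≤ q ^ (D u - (a + s))}.ncard ∧ ∀ u, q ^ (D u + 1 - a) < ω u} ≤
      ENNReal.ofReal (1 - q ^ (s + 1)) ^ k := by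
  let pow (m : ℕ) : I := ⟨q ^ m, pow_nonneg hq0 m, pow_le_one₀ hq0 hq1⟩
  have hratio (u : V) : (volume : Measure I)
      (Set.Iic (pow (D u - (a + s))) \ Set.Iic (pow (D u + 1 - a))) ≤
      ENNReal.ofReal (1 - q ^ (s + 1)) * volume (Set.Iic (pow (D u - (a + s)))) := by
    have hpow : q ^ (s + 1) * q ^ (D u - (a + s)) ≤ q ^ (D u + 1 - a) := by
      rw [← pow_add]
      exact pow_le_pow_of_le_one hq0 hq1 (by omega)
    rw [Set.sdiff_eq, Set.compl_Iic, Set.inter_comm, Set.Ioi_inter_Iic,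
      unitInterval.volume_Ioc, unitInterval.volume_Iic,
      ← ENNReal.ofReal_mul (sub_nonneg.2 (pow_le_one₀ hq0 hq1))]
    refine ENNReal.ofReal_le_ofReal ?_
    change q ^ (D u - (a + s)) - q ^ (D u + 1 - a) ≤ (1 - q ^ (s + 1)) * q ^ (D u - (a + s))
    linarith
  refine (measure_mono ?_).trans (measure_pi_le_ncard_and_forall_notMem_le
    (fun _ : V => (volume : Measure I)) (fun _ => measurableSet_Iic)
    (ENNReal.ofReal_le_one.2 (sub_le_self 1 (pow_nonneg hq0 _))) hratio k)
  exact fun ω hω => ⟨hω.1, fun u => not_le.2 (hω.2 u)⟩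

end GeometricShift

/-! ### Waves and their clusters -/

/-- Every node `u` of a network emits a wave at time `delay u`, which moves at unit speed. A node
joins the cluster of `u` if this wave arrives at most `slack` after the first one. -/
structure Wave (V : Type u) where
  net : Network V
  delay : V → ℕ
  cap : ℕ
  slack : ℕ
  delay_le : ∀ u, delay u ≤ cap

namespace Wave

variable {V : Type u} (P : Wave V)

/-- The time by which every node has joined all its clusters. -/
def horizon : ℕ := P.cap + P.slack

/-- The number of steps from `u` to `w`; waves do not reach other components by the horizon. -/
def hop (u w : V) : ℕ := distOr P.net.graph (P.horizon + 1) u w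

/-- The time of arrival at `w` of the wave of `u`. -/
def arrival (u w : V) : ℕ := P.delay u + P.hop u w

/-- The time of arrival at `w` of the first wave. -/
def firstArrival (w : V) : ℕ := ⨅ u, P.arrival u w

/-- `w` belongs to the cluster of `u`. -/
def Member (u w : V) : Prop := P.arrival u w ≤ P.firstArrival w + P.slack

/-- The wave of `u` arrives at `w` early enough that `w` may be a neighbor of a member of the
cluster of `u`. Only such pairs cause messages. -/
def AlmostMember (u w : V) : Prop := P.arrival u w ≤ P.firstArrival w + P.slack + 2

/-- Every node is an almost-member of at most `B` clusters. -/
def IsSparse (B : ℕ) : Prop := ∀ w, {u | P.AlmostMember u w}.ncard ≤ B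

/-- `x` precedes `w` on a shortest path from `u`. -/
def Pred (u w x : V) : Prop := P.net.graph.Adj x w ∧ P.hop u x + 1 = P.hop u w

open Classical in
/-- The parent of `w` in the cluster of `u`: the predecessor with the smallest identifier, and `w`
itself if there is none, as for `w = u`. -/
def par (u w : V) : V :=
  if h : {x | P.Pred u w x}.Nonempty then Function.argminOn P.net.ident _ h else w

variable {P} {u v w x : V}

theorem hop_self : P.hop u u = 0 := distOr_self

theorem hop_adj (h : P.net.graph.Adj x w) : P.hop u w ≤ P.hop u x + 1 := distOr_le_of_adj h

theorem hop_le_of_edist_le {r : ℕ} (h : P.net.graph.edist v w ≤ r) :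
    P.hop u w ≤ P.hop u v + r :=
  distOr_le_of_edist_le h

theorem eq_of_hop_eq_zero (h : P.hop u w = 0) : u = w :=
  eq_of_distOr_eq_zero P.horizon.succ_ne_zero h

theorem exists_pred (huw : u ≠ w) (h : P.hop u w ≤ P.horizon) : ∃ x, P.Pred u w x := by
  obtain ⟨x, hx, hhop⟩ := exists_adj_distOr_add_one (Nat.lt_succ_of_le h) huw
  exact ⟨x, hx.symm, hhop⟩

theorem arrival_self : P.arrival u u = P.delay u := by rw [arrival, hop_self, add_zero]

theorem arrival_adj (h : P.net.graph.Adj x w) : P.arrival u w ≤ P.arrival u x + 1 :=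
  Nat.add_le_add_left (hop_adj h) _

theorem arrival_le_of_edist_le {r : ℕ} (h : P.net.graph.edist v w ≤ r) :
    P.arrival u w ≤ P.arrival u v + r :=
  (Nat.add_le_add_left (hop_le_of_edist_le h) _).trans_eq (add_assoc _ _ _).symm

theorem Pred.arrival_eq (h : P.Pred u w x) : P.arrival u x + 1 = P.arrival u w :=
  congrArg (P.delay u + ·) h.2

theorem firstArrival_le (u w : V) : P.firstArrival w ≤ P.arrival u w := ciInf_le' _ _

variable (P) in
theorem exists_arrival_eq_firstArrival (w : V) : ∃ u, P.arrival u w = P.firstArrival w :=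
  have : Nonempty V := ⟨w⟩
  ciInf_mem fun u => P.arrival u w

theorem firstArrival_le_cap : P.firstArrival w ≤ P.cap :=
  (firstArrival_le w w).trans (arrival_self.trans_le (P.delay_le w))

theorem firstArrival_le_of_edist_le {r : ℕ} (h : P.net.graph.edist v w ≤ r) :
    P.firstArrival w ≤ P.firstArrival v + r := by
  obtain ⟨u, hu⟩ := P.exists_arrival_eq_firstArrival v
  exact (firstArrival_le u w).trans ((arrival_le_of_edist_le h).trans_eq (by rw [hu]))

theorem firstArrival_adj (h : P.net.graph.Adj x w) : P.firstArrival w ≤ P.firstArrival x + 1 :=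
  firstArrival_le_of_edist_le (r := 1) (SimpleGraph.edist_eq_one_iff_adj.2 h).le

theorem Member.arrival_le_horizon (h : P.Member u w) : P.arrival u w ≤ P.horizon :=
  le_trans h (Nat.add_le_add_right firstArrival_le_cap _)

theorem Member.hop_le_horizon (h : P.Member u w) : P.hop u w ≤ P.horizon :=
  (Nat.le_add_left _ _).trans h.arrival_le_horizon

theorem Member.of_pred (h : P.Member u w) (hx : P.Pred u w x) : P.Member u x := by
  have hfirst := firstArrival_adj hx.1
  have harrival := hx.arrival_eq
  unfold Member at *
  omega

theorem Member.almostMember (h : P.Member u w) : P.AlmostMember u w :=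
  le_add_of_le_left h

theorem Member.almostMember_of_adj (h : P.Member u w) (hx : P.net.graph.Adj w x) :
    P.AlmostMember u x := by
  have hfirst := firstArrival_adj hx.symm
  have harrival := arrival_adj (u := u) hx
  unfold Member AlmostMember at *
  omega

theorem par_self : P.par u u = u := by
  refine dif_neg ?_
  rintro ⟨x, -, hx⟩
  rw [hop_self] at hx
  exact absurd hx (Nat.succ_ne_zero _)

theorem Member.pred_par (huw : u ≠ w) (h : P.Member u w) : P.Pred u w (P.par u w) := by
  have hex : {x | P.Pred u w x}.Nonempty := exists_pred huw h.hop_le_horizon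
  rw [par, dif_pos hex]
  exact Function.argminOn_mem P.net.ident _ hex

theorem Pred.ident_par_le (h : P.Pred u w x) : P.net.ident (P.par u w) ≤ P.net.ident x := by
  rw [par, dif_pos ⟨x, h⟩]
  exact Function.argminOn_le P.net.ident _ h

theorem Member.par (h : P.Member u w) : P.Member u (P.par u w) := by
  by_cases huw : u = w
  · subst huw
    rwa [par_self]
  · exact h.of_pred (h.pred_par huw)

theorem Member.root (h : P.Member u w) : P.Member u u := by
  induction hm : P.hop u w generalizing w with
  | zero => rwa [← eq_of_hop_eq_zero hm] at h
  | succ m ih =>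
    have huw : u ≠ w := by
      rintro rfl
      rw [hop_self] at hm
      exact absurd hm m.succ_ne_zero.symm
    have hpred := h.pred_par huw
    exact ih h.par (by have := hpred.2; omega)

theorem member_of_arrival_eq_firstArrival (h : P.arrival u w = P.firstArrival w) :
    P.Member u w :=
  h.trans_le (Nat.le_add_right _ _)

-- The ball around `v` joins the cluster of the node whose wave is the first to arrive at `v`.
variable (P) in
theorem exists_forall_edist_le_member (v : V) {r : ℕ} (hr : 2 * r ≤ P.slack) :
    ∃ u, ∀ w, P.net.graph.edist v w ≤ r → P.Member u w := by
  obtain ⟨u, hu⟩ := P.exists_arrival_eq_firstArrival v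
  refine ⟨u, fun w hw => ?_⟩
  have harrival := arrival_le_of_edist_le (u := u) hw
  have hfirst := firstArrival_le_of_edist_le (SimpleGraph.edist_comm.trans_le hw)
  unfold Member
  omega

open Classical in
theorem IsSparse.card_almostMember_le [Fintype V] {B : ℕ} (h : P.IsSparse B) :
    Finset.card {p : V × V | P.AlmostMember p.1 p.2} ≤ B * Fintype.card V := by
  refine Finset.card_le_mul_card_image_of_maps_to (f := Prod.snd) (t := Finset.univ)
    (fun p _ => Finset.mem_univ _) B fun w _ => ?_
  rw [← Set.ncard_coe_finset]
  refine le_trans (Set.ncard_le_ncard_of_injOn Prod.fst ?_ ?_) (h w)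
  · rintro ⟨u, _⟩ hp
    obtain ⟨hu, rfl⟩ : P.AlmostMember u _ ∧ _ = w := by simpa using hp
    exact hu
  · rintro ⟨u, _⟩ hp ⟨u', _⟩ hp' huu'
    obtain ⟨-, rfl⟩ : P.AlmostMember u _ ∧ _ = w := by simpa using hp
    obtain ⟨-, rfl⟩ : P.AlmostMember u' _ ∧ _ = _ := by simpa using hp'
    exact congrArg (·, _) huu'

variable (P) in
/-- The cluster tree of `u`: every member other than `u` is joined to its parent. -/
def clusterTree (u : V) : P.net.graph.Subgraph where
  verts := {w | P.Member u w}
  Adj x y := P.Member u x ∧ P.Member u y ∧ ((x ≠ u ∧ P.par u x = y) ∨ (y ≠ u ∧ P.par u y = x))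
  adj_sub := by
    rintro x y ⟨hx, hy, ⟨hne, rfl⟩ | ⟨hne, rfl⟩⟩
    · exact (hx.pred_par hne.symm).1.symm
    · exact (hy.pred_par hne.symm).1
  edge_vert h := h.1
  symm := ⟨fun _ _ h => ⟨h.2.1, h.1, h.2.2.symm⟩⟩

theorem isParentMap_clusterTree (h : P.Member u u) :
    IsParentMap (P.clusterTree u).coe ⟨u, h⟩ (fun w => ⟨P.par u w, w.2.par⟩)
      (fun w => P.hop u w) where
  dep_root := hop_self
  dep_par w hw := (w.2.pred_par fun huw => hw (Subtype.ext huw.symm)).2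
  adj_iff x y := by
    simp only [ne_eq, Subtype.ext_iff]
    exact ⟨fun h => h.2.2, fun h => ⟨x.2, y.2, h⟩⟩

/-- The cluster of `u`. -/
def cluster [Finite V] (h : P.Member u u) : Cluster P.net.graph where
  tree := P.clusterTree u
  isTree := (isParentMap_clusterTree h).isTree
  root := ⟨u, h⟩

theorem depth_cluster_le [Finite V] (h : P.Member u u) : (cluster h).depth ≤ P.horizon :=
  have : Nonempty (cluster h).tree.verts := ⟨(cluster h).root⟩
  ciSup_le fun w => ((isParentMap_clusterTree h).dist_root w).trans_le (Member.hop_le_horizon w.2)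

theorem isParent_cluster_iff [Finite V] (h : P.Member u u) {v w : V} :
    (cluster h).IsParent v w ↔ P.Member u w ∧ u ≠ w ∧ P.par u w = v := by
  have hdist := (isParentMap_clusterTree h).dist_root
  constructor
  · rintro ⟨hv, hw, ⟨-, -, ⟨hne, rfl⟩ | ⟨hne, rfl⟩⟩, hdepth⟩
    · have hhop : P.hop u (P.par u v) = P.hop u v + 1 :=
        ((hdist ⟨_, hw⟩).symm.trans hdepth).trans (congrArg (· + 1) (hdist ⟨v, hv⟩))
      have := (Member.pred_par hne.symm hv).2
      omega
    · exact ⟨hw, hne.symm, rfl⟩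
  · rintro ⟨hw, hne, rfl⟩
    refine ⟨hw.par, hw, ⟨hw.par, hw, .inr ⟨hne.symm, rfl⟩⟩, ?_⟩
    exact ((hdist ⟨w, hw⟩).trans (hw.pred_par hne).2.symm).trans
      (congrArg (· + 1) (hdist ⟨_, hw.par⟩).symm)

end Wave

/-! ### The distributed algorithm -/

/-- The report that `node` has joined the cluster of `root` in phase `time`, at the given depth and
with the given parent, all nodes being named by their identifiers. -/
structure Report where
  root : ℕ
  node : ℕ
  time : ℕ
  depth : ℕ
  parent : Option ℕ
  nbrs : Finset ℕ

/-- In the light of the reports `R`, the node that made the report `f` in the previous phase has to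
invite `x` to the cluster in phase `k`: nobody did so before, and of all the nodes that could do so
now, it has the least identifier. This is what keeps the number of invitations small. -/
def Invites (R : Set Report) (k : ℕ) (f : Report) (x : ℕ) : Prop :=
  f ∈ R ∧ f.time + 1 = k ∧ x ∈ f.nbrs ∧ ∀ g ∈ R, g.root = f.root →
    g.node ≠ x ∧ (x ∈ g.nbrs → f.time ≤ g.time ∧ f.node ≤ g.node)

/-- In slot `j ∈ {1, …, H}` of a phase, the nodes `me` of depth `H + 1 - j` in a cluster tree send
what they know to their parents `x`. -/
def Upcasts (R : Set Report) (H j me x : ℕ) : Prop :=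
  ∃ f ∈ R, f.node = me ∧ f.parent = some x ∧ f.depth + j = H + 1

/-- In slot `j ∈ {H + 1, …, 2 * H}` of a phase, the parents `me` of the nodes `x` of depth `j - H`
in a cluster tree send what they know to `x`. -/
def Downcasts (R : Set Report) (H j me x : ℕ) : Prop :=
  ∃ f ∈ R, f.node = x ∧ f.parent = some me ∧ j = H + f.depth

/-- The node `me`, which knows the reports `R`, sends them to `x` in slot `j` of phase `k`. Slot `0`
is reserved for the invitations. -/
def SendsTo (R : Set Report) (H k j me x : ℕ) : Prop :=
  (j = 0 ∧ ∃ f, Invites R k f x ∧ f.node = me) ∨ Upcasts R H j me x ∨ Downcasts R H j me x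

/-- The number of rounds in a phase when the horizon is `H`. -/
def phaseLength (H : ℕ) : ℕ := 2 * H + 1

/-- The number of rounds of `H + 1` phases. -/
def roundCount (H : ℕ) : ℕ := (H + 1) * phaseLength H

/-- The state of a node: its input, the number of the round, and the reports that it knows. -/
structure NodeState where
  input : LocalInput
  clock : ℕ
  reports : Set Report

open Classical in
/-- The elements of a finite set of numbers (none, if the set is infinite). -/
def finsetOf (s : Set ℕ) : Finset ℕ := if h : s.Finite then h.toFinset else ∅

theorem mem_finsetOf {s : Set ℕ} (h : s.Finite) {x : ℕ} : x ∈ finsetOf s ↔ x ∈ s := by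
  rw [finsetOf, dif_pos h, Set.Finite.mem_toFinset]

open Classical in
/-- The output determined by the reports `R` that the node `me` knows. -/
def outputOf (R : Set Report) (me : ℕ) : LocalOutput where
  clusters := finsetOf {l | ∃ f ∈ R, f.node = me ∧ f.root = l}
  parent l := if h : ∃ x, ∃ f ∈ R, f.root = l ∧ f.node = me ∧ f.parent = some x
    then some h.choose else none
  children l := finsetOf {x | ∃ f ∈ R, f.root = l ∧ f.node = x ∧ f.parent = some me}

/-- How the nodes compute the parameters of the waves. Since `cap` and `slack` depend on `n`, `κ`
and `W` only, all nodes agree on them. -/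
structure Schedule where
  cap : ℕ → ℕ → ℕ → ℕ
  slack : ℕ → ℕ → ℕ → ℕ
  delay : LocalInput → ℕ
  delay_le : ∀ a, delay a ≤ cap a.n a.κ a.W

namespace Schedule

variable (S : Schedule)

/-- The time by which every node has joined all its clusters. -/
def horizon (a : LocalInput) : ℕ := S.cap a.n a.κ a.W + S.slack a.n a.κ a.W

/-- The reports that a node with input `a` makes about itself in phase `k`, when it knows the
reports `R` and receives the messages `inbox`: it starts its own cluster or accepts an
invitation, unless it joined a cluster more than `slack` phases ago. -/
def newReports (a : LocalInput) (R : Set Report) (k : ℕ) (inbox : ℕ → Option (Set Report)) :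
    Set Report :=
  {g | (∀ h ∈ R, h.node = a.ident → k ≤ h.time + S.slack a.n a.κ a.W) ∧
    ((S.delay a = k ∧ g = ⟨a.ident, a.ident, k, 0, none, a.nbrs⟩) ∨
      ∃ x m f, inbox x = some m ∧ f.node = x ∧ Invites m k f a.ident ∧
        g = ⟨f.root, a.ident, k, f.depth + 1, some x, a.nbrs⟩)}

open Classical in
/-- The message that a node sends to the neighbor `x`. -/
def send (s : NodeState) (x : ℕ) : Option (Set Report) :=
  if SendsTo s.reports (S.horizon s.input) (s.clock / phaseLength (S.horizon s.input))
    (s.clock % phaseLength (S.horizon s.input)) s.input.ident x then some s.reports else none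

/-- The state of a node after it has received the messages `inbox`. -/
def update (s : NodeState) (inbox : ℕ → Option (Set Report)) : NodeState where
  input := s.input
  clock := s.clock + 1
  reports := {g | g ∈ s.reports ∨ (∃ x m, inbox x = some m ∧ g ∈ m) ∨
    (s.clock % phaseLength (S.horizon s.input) = 0 ∧ g ∈ S.newReports s.input s.reports
      (s.clock / phaseLength (S.horizon s.input)) inbox)}

open Classical in
/-- The output of a node, which is produced after the last phase. -/
def output (s : NodeState) : Option LocalOutput :=
  if roundCount (S.horizon s.input) ≤ s.clock
    then some (outputOf s.reports s.input.ident) else none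

/-- The cluster-growing algorithm. -/
def algorithm : DistAlgorithm where
  State := NodeState
  Msg := Set Report
  start a := ⟨a, 0, ∅⟩
  send := S.send
  update := S.update
  output := S.output

end Schedule

namespace Wave

variable {V : Type u} [Fintype V] (P : Wave V)

open Classical in
/-- The identifiers of the neighbors of `v`. -/
def nbrIds (v : V) : Finset ℕ :=
  (Finset.univ.filter fun w => P.net.graph.Adj v w).image P.net.ident

open Classical in
/-- The report that `w` makes about itself when it joins the cluster of `u`. -/
def report (u w : V) : Report where
  root := P.net.ident u
  node := P.net.ident w
  time := P.arrival u w
  depth := P.hop u w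
  parent := if u = w then none else some (P.net.ident (P.par u w))
  nbrs := P.nbrIds w

/-- The number of rounds in a phase. -/
def phase : ℕ := phaseLength P.horizon

/-- The number of rounds of the algorithm. -/
def rounds : ℕ := roundCount P.horizon

/-- The report `g` is made by `v` in phase `k`, when the nodes know the reports `R`. -/
def Joins (R : V → Set Report) (k : ℕ) (v : V) (g : Report) : Prop :=
  (∀ h ∈ R v, h.node = P.net.ident v → k ≤ h.time + P.slack) ∧
  ((P.delay v = k ∧ g = ⟨P.net.ident v, P.net.ident v, k, 0, none, P.nbrIds v⟩) ∨
    ∃ w f, P.net.graph.Adj v w ∧ f.node = P.net.ident w ∧ Invites (R w) k f (P.net.ident v) ∧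
      g = ⟨f.root, P.net.ident v, k, f.depth + 1, some (P.net.ident w), P.nbrIds v⟩)

/-- `v` sends a message to `w` in round `t`, when the nodes know the reports `R`. -/
def Sends (R : V → Set Report) (t : ℕ) (v w : V) : Prop :=
  SendsTo (R v) P.horizon (t / P.phase) (t % P.phase) (P.net.ident v) (P.net.ident w)

/-- The sets `R t v` of the reports known to `v` after `t` rounds evolve according to the cluster
growing algorithm. -/
structure Evolves (R : ℕ → V → Set Report) : Prop where
  zero : ∀ v, R 0 v = ∅
  succ : ∀ t < P.rounds, ∀ v g, g ∈ R (t + 1) v ↔ g ∈ R t v ∨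
    (∃ w, P.net.graph.Adj v w ∧ P.Sends (R t) t w v ∧ g ∈ R t w) ∨
    (t % P.phase = 0 ∧ P.Joins (R t) (t / P.phase) v g)

end Wave

theorem DistAlgorithm.inbox_eq_some_iff {V : Type u} [Fintype V] (A : DistAlgorithm)
    {N : Network V} {s : V → A.State} {v : V} {x : ℕ} {m : A.Msg} :
    A.inbox N s v x = some m ↔
      ∃ w, N.graph.Adj v w ∧ N.ident w = x ∧ A.emit (s w) (N.ident v) = some m := by
  unfold DistAlgorithm.inbox
  constructor
  · intro h
    split_ifs at h with hw
    exact ⟨hw.choose, hw.choose_spec.1, hw.choose_spec.2, h⟩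
  · rintro ⟨w, hvw, rfl, hm⟩
    have hex : ∃ w', N.graph.Adj v w' ∧ N.ident w' = N.ident w := ⟨w, hvw, rfl⟩
    rw [dif_pos hex, N.ident.injective hex.choose_spec.2, hm]

namespace Schedule

variable {V : Type u} [Fintype V] (S : Schedule) (N : Network V) (κ W : ℕ) (ω : V → I)

/-- The waves that the nodes emit when their seeds are `ω`. -/
def wave : Wave V where
  net := N
  delay v := S.delay (DistAlgorithm.localInput N κ W (ω v) v)
  cap := S.cap (Fintype.card V) κ W
  slack := S.slack (Fintype.card V) κ W
  delay_le v := S.delay_le (DistAlgorithm.localInput N κ W (ω v) v)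

/-- The state of the node `v` after `t` rounds. -/
def state (t : ℕ) (v : V) : NodeState := S.algorithm.run N κ W ω t v

/-- The reports that the node `v` knows after `t` rounds. -/
def known (t : ℕ) (v : V) : Set Report := (S.state N κ W ω t v).reports

/-- The messages that the node `v` receives in round `t`. -/
def received (t : ℕ) (v : V) : ℕ → Option (Set Report) :=
  S.algorithm.inbox N (S.state N κ W ω t) v

variable {S N κ W ω} {t : ℕ} {v w : V}

theorem isSome_output_iff {s : NodeState} :
    (S.output s).isSome ↔ roundCount (S.horizon s.input) ≤ s.clock := by
  unfold output
  split_ifs with h <;> simp [h]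

theorem state_input_clock (ht : t ≤ (S.wave N κ W ω).rounds) (v : V) :
    (S.state N κ W ω t v).input = DistAlgorithm.localInput N κ W (ω v) v ∧
      (S.state N κ W ω t v).clock = t := by
  induction t with
  | zero => exact ⟨rfl, rfl⟩
  | succ t ih =>
    obtain ⟨hinput, hclock⟩ := ih (by omega)
    have hrun : ¬ (S.output (S.state N κ W ω t v)).isSome := by
      rw [isSome_output_iff, hinput, hclock]
      exact not_le.2 ht
    have hsucc : S.state N κ W ω (t + 1) v =
      S.update (S.state N κ W ω t v) (S.received N κ W ω t v) := if_neg hrun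
    rw [hsucc]
    exact ⟨hinput, congrArg (· + 1) hclock⟩

theorem not_isSome_output_state (ht : t < (S.wave N κ W ω).rounds) (v : V) :
    ¬ (S.output (S.state N κ W ω t v)).isSome := by
  obtain ⟨hinput, hclock⟩ := state_input_clock ht.le v
  rw [isSome_output_iff, hinput, hclock]
  exact not_le.2 ht

theorem state_succ (ht : t < (S.wave N κ W ω).rounds) (v : V) :
    S.state N κ W ω (t + 1) v = S.update (S.state N κ W ω t v) (S.received N κ W ω t v) :=
  if_neg (not_isSome_output_state ht v)

theorem output_run : S.algorithm.output (S.algorithm.run N κ W ω (S.wave N κ W ω).rounds v) =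
    some (outputOf (S.known N κ W ω (S.wave N κ W ω).rounds v) (N.ident v)) := by
  obtain ⟨hinput, hclock⟩ := state_input_clock (le_refl (S.wave N κ W ω).rounds) v
  change S.output (S.state N κ W ω _ v) = _
  rw [output, hinput, hclock]
  exact if_pos le_rfl

theorem emit_eq_some_iff (ht : t < (S.wave N κ W ω).rounds) {m : Set Report} :
    S.algorithm.emit (S.state N κ W ω t v) (N.ident w) = some m ↔
      (S.wave N κ W ω).Sends (S.known N κ W ω t) t v w ∧ S.known N κ W ω t v = m := by
  obtain ⟨hinput, hclock⟩ := state_input_clock ht.le v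
  have hemit : S.algorithm.emit (S.state N κ W ω t v) (N.ident w) =
    S.send (S.state N κ W ω t v) (N.ident w) := if_neg (not_isSome_output_state ht v)
  rw [hemit, send, hinput, hclock]
  exact Option.ite_none_right_eq_some.trans (and_congr_right fun _ => Option.some_inj)

theorem received_eq_some_iff (ht : t < (S.wave N κ W ω).rounds) {x : ℕ} {m : Set Report} :
    S.received N κ W ω t v x = some m ↔ ∃ w, N.graph.Adj v w ∧ N.ident w = x ∧
      (S.wave N κ W ω).Sends (S.known N κ W ω t) t w v ∧ S.known N κ W ω t w = m :=
  S.algorithm.inbox_eq_some_iff.trans <| exists_congr fun _ => and_congr_right fun _ =>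
    and_congr_right fun _ => emit_eq_some_iff ht

theorem mem_newReports_received_iff (ht : t < (S.wave N κ W ω).rounds)
    (hslot : t % (S.wave N κ W ω).phase = 0) {g : Report} :
    g ∈ S.newReports (DistAlgorithm.localInput N κ W (ω v) v) (S.known N κ W ω t v)
        (t / (S.wave N κ W ω).phase) (S.received N κ W ω t v) ↔
      (S.wave N κ W ω).Joins (S.known N κ W ω t) (t / (S.wave N κ W ω).phase) v g := by
  refine and_congr_right fun _ => or_congr_right ⟨?_, ?_⟩
  · rintro ⟨x, m, f, hm, hfx, hf, hg⟩
    obtain ⟨w, hvw, rfl, -, rfl⟩ := (received_eq_some_iff ht).1 hm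
    exact ⟨w, f, hvw, hfx, hf, hg⟩
  · rintro ⟨w, f, hvw, hfw, hf, hg⟩
    exact ⟨_, _, f, (received_eq_some_iff ht).2
      ⟨w, hvw, rfl, .inl ⟨hslot, f, hf, hfw⟩, rfl⟩, hfw, hf, hg⟩

variable (S N κ W ω) in
theorem evolves_known : (S.wave N κ W ω).Evolves (S.known N κ W ω) where
  zero v := rfl
  succ t ht v g := by
    obtain ⟨hinput, hclock⟩ := state_input_clock ht.le v
    rw [known, state_succ ht, update, hinput, hclock]
    refine or_congr_right (or_congr ⟨?_, ?_⟩
      (and_congr_right fun hslot => mem_newReports_received_iff ht hslot))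
    · rintro ⟨x, m, hm, hg⟩
      obtain ⟨w, hvw, -, hsends, rfl⟩ := (received_eq_some_iff ht).1 hm
      exact ⟨w, hvw, hsends, hg⟩
    · rintro ⟨w, hvw, hsends, hg⟩
      exact ⟨_, _, (received_eq_some_iff ht).2 ⟨w, hvw, rfl, hsends, rfl⟩, hg⟩

end Schedule

/-! ### Correctness of the phases -/

namespace Wave

variable {V : Type u} {P : Wave V}

theorem slot_lt_rounds {k j : ℕ} (hk : k ≤ P.horizon) (hj : j < P.phase) :
    k * P.phase + j < P.rounds :=
  calc k * P.phase + j < (k + 1) * P.phase := by rw [Nat.succ_mul]; omega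
    _ ≤ P.rounds := Nat.mul_le_mul_right _ (by omega)

variable [Fintype V]

theorem ident_mem_nbrIds {v w : V} : P.net.ident w ∈ P.nbrIds v ↔ P.net.graph.Adj v w := by
  simp [nbrIds]

theorem parent_report {u w : V} {x : ℕ} :
    (P.report u w).parent = some x ↔ u ≠ w ∧ P.net.ident (P.par u w) = x := by
  unfold report
  by_cases h : u = w <;> simp [h]

theorem report_self (u : V) :
    P.report u u = ⟨P.net.ident u, P.net.ident u, P.delay u, 0, none, P.nbrIds u⟩ := by
  simp [report, arrival_self, hop_self]

theorem Member.report_eq {u w : V} (huw : u ≠ w) (h : P.Member u w) :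
    P.report u w = ⟨(P.report u (P.par u w)).root, P.net.ident w, P.arrival u w,
      (P.report u (P.par u w)).depth + 1, some (P.net.ident (P.par u w)), P.nbrIds w⟩ := by
  simp [report, huw, (h.pred_par huw).2]

variable (P) in
/-- All reports in `R` are true, and made before phase `k`. -/
def Sound (R : V → Set Report) (k : ℕ) : Prop :=
  ∀ v, ∀ f ∈ R v, ∃ u w, P.Member u w ∧ P.arrival u w < k ∧ f = P.report u w

variable (P) in
/-- The nodes know all the reports that they made before phase `k`. -/
def Own (R : V → Set Report) (k : ℕ) : Prop :=
  ∀ u v, P.Member u v → P.arrival u v < k → P.report u v ∈ R v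

variable (P) in
/-- The nodes know all the reports made before phase `k` in the clusters that they joined before
phase `k`. -/
def Complete (R : V → Set Report) (k : ℕ) : Prop :=
  ∀ u v w, P.Member u v → P.Member u w → P.arrival u v < k → P.arrival u w < k →
    P.report u w ∈ R v

section Joins

variable {R : V → Set Report} {k : ℕ} {u x z : V} {f g : Report}

theorem Complete.own (h : P.Complete R k) : P.Own R k :=
  fun u v hm ha => h u v v hm hm ha ha

theorem Sound.mono {l : ℕ} (h : P.Sound R k) (hkl : k ≤ l) : P.Sound R l := fun v f hf =>
  let ⟨u, w, hm, ha, hfw⟩ := h v f hf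
  ⟨u, w, hm, ha.trans_le hkl, hfw⟩

theorem Sound.exists_of_invites (hs : P.Sound R k) (hf : f.node = P.net.ident x)
    (hi : Invites (R x) k f (P.net.ident z)) :
    ∃ u, P.Member u x ∧ P.arrival u x + 1 = k ∧ P.net.graph.Adj x z ∧ f = P.report u x := by
  obtain ⟨hfR, htime, hnbr, -⟩ := hi
  obtain ⟨u, w, hm, -, rfl⟩ := hs x f hfR
  obtain rfl : w = x := P.net.ident.injective hf
  exact ⟨u, hm, htime, ident_mem_nbrIds.1 hnbr, rfl⟩

theorem le_firstArrival_add_slack_iff (hs : P.Sound R k) (ho : P.Own R k) :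
    k ≤ P.firstArrival z + P.slack ↔
      ∀ h ∈ R z, h.node = P.net.ident z → k ≤ h.time + P.slack := by
  constructor
  · intro hk h hh hnode
    obtain ⟨u, w, -, -, rfl⟩ := hs z h hh
    obtain rfl : w = z := P.net.ident.injective hnode
    exact hk.trans (Nat.add_le_add_right (firstArrival_le u w) _)
  · intro h
    by_contra! hk
    obtain ⟨u, hu⟩ := P.exists_arrival_eq_firstArrival z
    have hlate : k ≤ P.arrival u z + P.slack :=
      h _ (ho u z (member_of_arrival_eq_firstArrival hu) (by omega)) rfl
    omega

theorem Sound.par_invites (hs : P.Sound R k) (ho : P.Own R k) (huz : u ≠ z)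
    (hm : P.Member u z) (ha : P.arrival u z = k) :
    Invites (R (P.par u z)) k (P.report u (P.par u z)) (P.net.ident z) := by
  have hpred := hm.pred_par huz
  have hpar : P.arrival u (P.par u z) + 1 = k := hpred.arrival_eq.trans ha
  refine ⟨ho u _ hm.par (by omega), hpar, ident_mem_nbrIds.2 hpred.1, fun g hg hroot => ?_⟩
  obtain ⟨u', y, -, hy, rfl⟩ := hs _ g hg
  obtain rfl : u' = u := P.net.ident.injective hroot
  constructor
  · intro hyz
    obtain rfl : y = z := P.net.ident.injective hyz
    omega
  · intro hzy
    have hadj : P.net.graph.Adj y z := ident_mem_nbrIds.1 hzy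
    have hle := arrival_adj (u := u') hadj
    have hyz : P.arrival u' y + 1 = P.arrival u' z := by omega
    have hpred_y : P.Pred u' z y := ⟨hadj, by unfold arrival at hyz; omega⟩
    exact ⟨show P.arrival u' (P.par u' z) ≤ P.arrival u' y by omega, hpred_y.ident_par_le⟩

theorem Sound.exists_member_of_invites (hs : P.Sound R k) (hc : P.Complete R k)
    (hk : k ≤ P.firstArrival z + P.slack) (hf : f.node = P.net.ident x)
    (hi : Invites (R x) k f (P.net.ident z)) :
    ∃ u, P.Member u z ∧ P.arrival u z = k ∧ u ≠ z ∧ P.par u z = x ∧ f = P.report u x := by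
  obtain ⟨u, hmx, hax, hadj, rfl⟩ := hs.exists_of_invites hf hi
  have hle : P.arrival u z ≤ k := hax ▸ arrival_adj hadj
  have hmz : P.Member u z := hle.trans hk
  have haz : P.arrival u z = k := by
    by_contra hne
    exact (hi.2.2.2 _ (hc u x z hmx hmz (by omega) (by omega)) rfl).1 rfl
  have huz : u ≠ z := by
    rintro rfl
    have hmin : P.arrival u u ≤ P.arrival u x := arrival_self.trans_le (Nat.le_add_right _ _)
    omega
  have hpar := hmz.pred_par huz
  have hpred : P.Pred u z x := ⟨hadj, by unfold arrival at hax haz; omega⟩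
  refine ⟨u, hmz, haz, huz, P.net.ident.injective (hpred.ident_par_le.antisymm ?_), rfl⟩
  have hknown : P.report u (P.par u z) ∈ R x :=
    hc u x _ hmx hmz.par (by omega) (by have := hpar.arrival_eq; omega)
  exact ((hi.2.2.2 _ hknown rfl).2 (ident_mem_nbrIds.2 hpar.1)).2

theorem joins_iff (hs : P.Sound R k) (hc : P.Complete R k) :
    P.Joins R k z g ↔ ∃ u, P.Member u z ∧ P.arrival u z = k ∧ g = P.report u z := by
  rw [Joins, ← le_firstArrival_add_slack_iff hs hc.own]
  constructor
  · rintro ⟨hk, ⟨rfl, rfl⟩ | ⟨x, f, -, hf, hi, rfl⟩⟩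
    · exact ⟨z, arrival_self.trans_le hk, arrival_self, (report_self z).symm⟩
    · obtain ⟨u, hm, rfl, huz, rfl, rfl⟩ := hs.exists_member_of_invites hc hk hf hi
      exact ⟨u, hm, rfl, (hm.report_eq huz).symm⟩
  · rintro ⟨u, hm, rfl, rfl⟩
    refine ⟨hm, ?_⟩
    by_cases huz : u = z
    · subst huz
      exact .inl ⟨arrival_self.symm, by rw [report_self, arrival_self]⟩
    · exact .inr ⟨P.par u z, P.report u (P.par u z), (hm.pred_par huz).1.symm, rfl,
        hs.par_invites hc.own huz hm rfl, hm.report_eq huz⟩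

end Joins

namespace Evolves

variable {R : ℕ → V → Set Report} (hR : P.Evolves R) {k j : ℕ} {u v w : V}
include hR

theorem mem_of_le {s t : ℕ} (hst : s ≤ t) (ht : t ≤ P.rounds) {g : Report} (hg : g ∈ R s v) :
    g ∈ R t v := by
  induction t, hst using Nat.le_induction with
  | base => exact hg
  | succ t _ ih => exact (hR.succ t ht v g).2 (.inl (ih (by omega)))

theorem mem_succ_slot_iff (hk : k ≤ P.horizon) (hj : j < P.phase) {g : Report} :
    g ∈ R (k * P.phase + (j + 1)) v ↔ g ∈ R (k * P.phase + j) v ∨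
      (∃ w, P.net.graph.Adj v w ∧ SendsTo (R (k * P.phase + j) w) P.horizon k j
        (P.net.ident w) (P.net.ident v) ∧ g ∈ R (k * P.phase + j) w) ∨
      (j = 0 ∧ P.Joins (R (k * P.phase + j)) k v g) := by
  have hdiv : (k * P.phase + j) / P.phase = k := by
    rw [mul_comm, Nat.mul_add_div (by omega), Nat.div_eq_of_lt hj, add_zero]
  have hmod : (k * P.phase + j) % P.phase = j := by
    rw [mul_comm, Nat.mul_add_mod, Nat.mod_eq_of_lt hj]
  have hsucc := hR.succ _ (slot_lt_rounds hk hj) v g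
  simp only [Sends, hdiv, hmod] at hsucc
  exact hsucc

theorem sound_first_slot (hk : k ≤ P.horizon) (hs : P.Sound (R (k * P.phase)) k)
    (hc : P.Complete (R (k * P.phase)) k) : P.Sound (R (k * P.phase + 1)) (k + 1) := by
  intro v g hg
  rcases (hR.mem_succ_slot_iff (j := 0) hk (Nat.succ_pos _)).1 hg with
    hg | ⟨w, -, -, hg⟩ | ⟨-, hg⟩
  · exact hs.mono k.le_succ v g hg
  · exact hs.mono k.le_succ w g hg
  · obtain ⟨u, hm, ha, hgu⟩ := (joins_iff hs hc).1 hg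
    exact ⟨u, v, hm, ha.trans_lt k.lt_succ_self, hgu⟩

theorem own_first_slot (hk : k ≤ P.horizon) (hs : P.Sound (R (k * P.phase)) k)
    (hc : P.Complete (R (k * P.phase)) k) : P.Own (R (k * P.phase + 1)) (k + 1) := by
  intro u v hm ha
  refine (hR.mem_succ_slot_iff (j := 0) hk (Nat.succ_pos _)).2 ?_
  rcases Nat.lt_succ_iff_lt_or_eq.1 ha with hlt | heq
  · exact .inl (hc.own u v hm hlt)
  · exact .inr (.inr ⟨rfl, (joins_iff hs hc).2 ⟨u, hm, heq, rfl⟩⟩)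

theorem sound_slot (hk : k ≤ P.horizon) (hs : P.Sound (R (k * P.phase + 1)) (k + 1))
    (hj : j < P.phase) : P.Sound (R (k * P.phase + (j + 1))) (k + 1) := by
  induction j with
  | zero => exact hs
  | succ j ih =>
    have hs' := ih (by omega)
    intro v g hg
    rcases (hR.mem_succ_slot_iff hk hj).1 hg with hg | ⟨w, -, -, hg⟩ | ⟨h, -⟩
    · exact hs' v g hg
    · exact hs' w g hg
    · exact absurd h j.succ_ne_zero

theorem convergecast (hk : k ≤ P.horizon) (ho : P.Own (R (k * P.phase + 1)) (k + 1))
    (hj : j ≤ P.horizon) (hw : P.Member u w) (haw : P.arrival u w < k + 1) :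
    ∃ x, P.Member u x ∧ P.arrival u x < k + 1 ∧ P.hop u x + j ≤ P.horizon ∧
      P.report u w ∈ R (k * P.phase + (j + 1)) x := by
  induction j with
  | zero => exact ⟨w, hw, haw, hw.hop_le_horizon, ho u w hw haw⟩
  | succ j ih =>
    obtain ⟨x, hx, hax, hdepth, hknown⟩ := ih (by omega)
    have hj' : j + 1 < P.phase := by unfold phase phaseLength; omega
    by_cases hlt : P.hop u x + (j + 1) ≤ P.horizon
    · exact ⟨x, hx, hax, hlt, (hR.mem_succ_slot_iff hk hj').2 (.inl hknown)⟩
    · have hux : u ≠ x := by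
        rintro rfl
        rw [hop_self] at hlt
        omega
      have hpred := hx.pred_par hux
      have hown : P.report u x ∈ R (k * P.phase + (j + 1)) x :=
        hR.mem_of_le (by omega) (slot_lt_rounds hk hj').le (ho u x hx hax)
      have harrival := hpred.arrival_eq
      have hhop := hpred.2
      refine ⟨P.par u x, hx.par, by omega, by omega, (hR.mem_succ_slot_iff hk hj').2 (.inr (.inl
          ⟨x, hpred.1, .inr (.inl ⟨_, hown, rfl, parent_report.2 ⟨hux, rfl⟩, ?_⟩), hknown⟩))⟩
      exact (by omega : P.hop u x + (j + 1) = P.horizon + 1)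

theorem broadcast (hk : k ≤ P.horizon) (ho : P.Own (R (k * P.phase + 1)) (k + 1))
    (hj : j ≤ P.horizon) (hv : P.Member u v) (hav : P.arrival u v < k + 1) (hdepth : P.hop u v ≤ j)
    (hw : P.Member u w) (haw : P.arrival u w < k + 1) :
    P.report u w ∈ R (k * P.phase + (P.horizon + j + 1)) v := by
  induction j generalizing v w with
  | zero =>
    obtain ⟨x, -, -, hx, hknown⟩ := hR.convergecast hk ho le_rfl hw haw
    obtain rfl : u = x := eq_of_hop_eq_zero (P := P) (by omega)
    obtain rfl : u = v := eq_of_hop_eq_zero (P := P) (by omega)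
    exact hknown
  | succ j ih =>
    have hj' : P.horizon + j + 1 < P.phase := by unfold phase phaseLength; omega
    by_cases hle : P.hop u v ≤ j
    · exact (hR.mem_succ_slot_iff hk hj').2 (.inl (ih (by omega) hv hav hle hw haw))
    · have huv : u ≠ v := by
        rintro rfl
        rw [hop_self] at hle
        omega
      have hpred := hv.pred_par huv
      have harrival := hpred.arrival_eq
      have hhop := hpred.2
      have hpar {y : V} (hy : P.Member u y) (hay : P.arrival u y < k + 1) :
          P.report u y ∈ R (k * P.phase + (P.horizon + j + 1)) (P.par u v) :=
        ih (by omega) hv.par (by omega) (by omega) hy hay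
      refine (hR.mem_succ_slot_iff hk hj').2 (.inr (.inl ⟨P.par u v, hpred.1.symm,
        .inr (.inr ⟨_, hpar hv hav, rfl, parent_report.2 ⟨huv, rfl⟩, ?_⟩), hpar hw haw⟩))
      exact (by omega : P.horizon + j + 1 = P.horizon + P.hop u v)

theorem sound_and_complete (hk : k ≤ P.horizon + 1) :
    P.Sound (R (k * P.phase)) k ∧ P.Complete (R (k * P.phase)) k := by
  induction k with
  | zero =>
    refine ⟨fun v f hf => ?_, fun u v w _ _ h => absurd h (Nat.not_lt_zero _)⟩
    rw [zero_mul, hR.zero] at hf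
    exact hf.elim
  | succ k ih =>
    obtain ⟨hs, hc⟩ := ih (by omega)
    have hk' : k ≤ P.horizon := by omega
    have hlast : (k + 1) * P.phase = k * P.phase + (P.horizon + P.horizon + 1) := by
      unfold phase phaseLength
      ring
    rw [hlast]
    refine ⟨hR.sound_slot hk' (hR.sound_first_slot hk' hs hc) ?_, fun u v w hv hw hav haw =>
      hR.broadcast hk' (hR.own_first_slot hk' hs hc) le_rfl hv hav hv.hop_le_horizon hw haw⟩
    unfold phase phaseLength
    omega

theorem exists_of_mem_rounds {f : Report} (hf : f ∈ R P.rounds v) :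
    ∃ u w, P.Member u w ∧ f = P.report u w :=
  let ⟨u, w, hm, _, hfw⟩ := (hR.sound_and_complete le_rfl).1 v f hf
  ⟨u, w, hm, hfw⟩

theorem report_mem_rounds (hv : P.Member u v) (hw : P.Member u w) :
    P.report u w ∈ R P.rounds v :=
  (hR.sound_and_complete le_rfl).2 u v w hv hw (Nat.lt_succ_of_le hv.arrival_le_horizon)
    (Nat.lt_succ_of_le hw.arrival_le_horizon)

end Evolves
end Wave

/-! ### The output -/

namespace Wave

variable {V : Type u} [Fintype V] {P : Wave V}

namespace Evolves

variable {R : ℕ → V → Set Report} (hR : P.Evolves R) {u v : V} {x : ℕ}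
include hR

theorem mem_clusters_iff {l : ℕ} :
    l ∈ (outputOf (R P.rounds v) (P.net.ident v)).clusters ↔
      ∃ u, P.net.ident u = l ∧ P.Member u v := by
  have hreports (l : ℕ) : (∃ f ∈ R P.rounds v, f.node = P.net.ident v ∧ f.root = l) ↔
      ∃ u, P.net.ident u = l ∧ P.Member u v := by
    constructor
    · rintro ⟨f, hf, hnode, rfl⟩
      obtain ⟨u, w, hm, rfl⟩ := hR.exists_of_mem_rounds hf
      obtain rfl : w = v := P.net.ident.injective hnode
      exact ⟨u, rfl, hm⟩
    · rintro ⟨u, rfl, hm⟩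
      exact ⟨_, hR.report_mem_rounds hm hm, rfl, rfl⟩
  refine (mem_finsetOf ((Set.finite_range P.net.ident).subset fun l hl => ?_)).trans (hreports l)
  obtain ⟨u, hu, -⟩ := (hreports l).1 hl
  exact ⟨u, hu⟩

theorem parent_eq_some_iff (hm : P.Member u v) :
    (outputOf (R P.rounds v) (P.net.ident v)).parent (P.net.ident u) = some x ↔
      u ≠ v ∧ P.net.ident (P.par u v) = x := by
  have hreports (x : ℕ) : (∃ f ∈ R P.rounds v, f.root = P.net.ident u ∧
      f.node = P.net.ident v ∧ f.parent = some x) ↔ u ≠ v ∧ P.net.ident (P.par u v) = x := by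
    constructor
    · rintro ⟨f, hf, hroot, hnode, hpar⟩
      obtain ⟨u', w, -, rfl⟩ := hR.exists_of_mem_rounds hf
      obtain rfl : w = v := P.net.ident.injective hnode
      obtain rfl : u' = u := P.net.ident.injective hroot
      exact parent_report.1 hpar
    · exact fun h => ⟨_, hR.report_mem_rounds hm hm, rfl, rfl, parent_report.2 h⟩
  simp only [outputOf]
  split_ifs with hex
  · obtain ⟨huv, hpar⟩ := (hreports _).1 hex.choose_spec
    rw [Option.some_inj, ← hpar, and_iff_right huv]
  · simp only [hreports, not_exists] at hex
    simp [hex x]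

theorem mem_children_iff (hm : P.Member u v) :
    x ∈ (outputOf (R P.rounds v) (P.net.ident v)).children (P.net.ident u) ↔
      ∃ w, P.net.ident w = x ∧ P.Member u w ∧ u ≠ w ∧ P.par u w = v := by
  have hreports (x : ℕ) : (∃ f ∈ R P.rounds v, f.root = P.net.ident u ∧ f.node = x ∧
      f.parent = some (P.net.ident v)) ↔
      ∃ w, P.net.ident w = x ∧ P.Member u w ∧ u ≠ w ∧ P.par u w = v := by
    constructor
    · rintro ⟨f, hf, hroot, rfl, hpar⟩
      obtain ⟨u', w, hw, rfl⟩ := hR.exists_of_mem_rounds hf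
      obtain rfl : u' = u := P.net.ident.injective hroot
      obtain ⟨huw, hpar⟩ := parent_report.1 hpar
      exact ⟨w, rfl, hw, huw, P.net.ident.injective hpar⟩
    · rintro ⟨w, rfl, hw, huw, rfl⟩
      exact ⟨_, hR.report_mem_rounds hm hw, rfl, rfl, parent_report.2 ⟨huw, rfl⟩⟩
  refine (mem_finsetOf ((Set.finite_range P.net.ident).subset fun x hx => ?_)).trans (hreports x)
  obtain ⟨w, hw, -⟩ := (hreports x).1 hx
  exact ⟨w, hw⟩

end Evolves

variable (P) in
open Classical in
/-- The names of the clusters: a cluster is named after its root. -/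
def names : Finset ℕ := (Finset.univ.filter fun u => P.Member u u).image P.net.ident

theorem mem_names_iff {l : ℕ} : l ∈ P.names ↔ ∃ u, P.Member u u ∧ P.net.ident u = l := by
  simp [names]

theorem Member.ident_mem_names {u v : V} (h : P.Member u v) : P.net.ident u ∈ P.names :=
  mem_names_iff.2 ⟨u, h.root, rfl⟩

/-- The root of the cluster with a given name. -/
def rootOf (i : P.names) : V := (mem_names_iff.1 i.2).choose

theorem member_rootOf (i : P.names) : P.Member (rootOf i) (rootOf i) :=
  (mem_names_iff.1 i.2).choose_spec.1

theorem ident_rootOf (i : P.names) : P.net.ident (rootOf i) = i :=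
  (mem_names_iff.1 i.2).choose_spec.2

theorem rootOf_injective : Function.Injective (rootOf : P.names → V) := fun i j hij =>
  Subtype.ext ((ident_rootOf i).symm.trans ((congrArg P.net.ident hij).trans (ident_rootOf j)))

theorem rootOf_ident {u : V} (h : P.net.ident u ∈ P.names) : rootOf ⟨P.net.ident u, h⟩ = u :=
  P.net.ident.injective (ident_rootOf _)

/-- The cluster with a given name. -/
def clusterOf (i : P.names) : Cluster P.net.graph := cluster (member_rootOf i)

theorem mem_clusterOf_iff {i : P.names} {v : V} :
    v ∈ (clusterOf i).tree.verts ↔ P.Member (rootOf i) v := Iff.rfl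

theorem Evolves.represents {R : ℕ → V → Set Report} (hR : P.Evolves R) :
    Represents P.net (fun v => outputOf (R P.rounds v) (P.net.ident v)) P.names clusterOf where
  mem_clusters v l := by
    rw [hR.mem_clusters_iff]
    constructor
    · rintro ⟨u, rfl, hm⟩
      refine ⟨hm.ident_mem_names, ?_⟩
      rwa [mem_clusterOf_iff, rootOf_ident]
    · rintro ⟨h, hm⟩
      exact ⟨_, ident_rootOf _, hm⟩
  parent_eq i v hv x := by
    rw [← ident_rootOf i, hR.parent_eq_some_iff hv]
    simp only [clusterOf, isParent_cluster_iff]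
    constructor
    · rintro ⟨hne, hpar⟩
      exact ⟨_, hpar, hv, hne, rfl⟩
    · rintro ⟨p, hpar, -, hne, rfl⟩
      exact ⟨hne, hpar⟩
  mem_children i v hv x := by
    rw [← ident_rootOf i, hR.mem_children_iff hv]
    simp only [clusterOf, isParent_cluster_iff]

theorem isSparseNeighborhoodCover_clusterOf {C : ℝ} {κ W B r : ℕ}
    (hball : ∀ v w, P.net.graph.edist v w ≤ W → P.net.graph.edist v w ≤ r)
    (hr : 2 * r ≤ P.slack) (hdepth : (P.horizon : ℝ) ≤ C * (W * κ)) (hsparse : P.IsSparse B)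
    (hB : (B : ℝ) ≤
      C * (κ * (Fintype.card V : ℝ) ^ (1 / (κ : ℝ)) * Real.log (Fintype.card V))) :
    IsSparseNeighborhoodCover C κ W (clusterOf : P.names → Cluster P.net.graph) where
  depth_le i := le_trans (mod_cast depth_cluster_le (member_rootOf i)) hdepth
  sparsity v := by
    refine le_trans (mod_cast ?_) hB
    exact (Set.ncard_le_ncard_of_injOn rootOf (fun i hi => Member.almostMember hi)
      rootOf_injective.injOn).trans (hsparse v)
  neighborhood v := by
    obtain ⟨u, hu⟩ := P.exists_forall_edist_le_member v hr
    have hv : P.Member u v := hu v (by simp)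
    refine ⟨⟨P.net.ident u, hv.ident_mem_names⟩, fun w hw => ?_⟩
    rw [mem_clusterOf_iff, rootOf_ident]
    exact hu w (hball v w hw)

end Wave

/-! ### The number of messages -/

namespace Wave

variable {V : Type u} {P : Wave V}

theorem div_phase_lt {t : ℕ} (ht : t < P.rounds) : t / P.phase < P.horizon + 1 :=
  Nat.div_lt_of_lt_mul (ht.trans_eq (Nat.mul_comm _ _))

variable [Fintype V]

variable (P) in
open Classical in
/-- The triples of a round `t` and two nodes `v` and `w` with the property `Q t v w`; they stand for
the messages of a certain kind that are sent from `v` to `w`. -/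
def events (Q : ℕ → V → V → Prop) : Finset (ℕ × V × V) :=
  (Finset.range P.rounds ×ˢ Finset.univ).filter fun p => Q p.1 p.2.1 p.2.2

theorem mem_events_iff {Q : ℕ → V → V → Prop} {t : ℕ} {v w : V} :
    (t, v, w) ∈ P.events Q ↔ t < P.rounds ∧ Q t v w := by
  simp [events]

theorem card_events_or_le (Q Q' : ℕ → V → V → Prop) :
    (P.events fun t v w => Q t v w ∨ Q' t v w).card ≤ (P.events Q).card + (P.events Q').card := by
  classical
  refine (Finset.card_le_card ?_).trans (Finset.card_union_le _ _)
  rintro ⟨t, v, w⟩ h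
  obtain ⟨ht, hQ⟩ := mem_events_iff.1 h
  exact Finset.mem_union.2
    (hQ.imp (fun h => mem_events_iff.2 ⟨ht, h⟩) fun h => mem_events_iff.2 ⟨ht, h⟩)

theorem Complete.le_of_invites {R : V → Set Report} {k : ℕ} {u v v' w : V}
    (hc : P.Complete R k) (hi : Invites (R v) k (P.report u v) (P.net.ident w))
    (hm : P.Member u v) (hm' : P.Member u v') (ha : P.arrival u v < k) (ha' : P.arrival u v' < k)
    (hadj : P.net.graph.Adj v' w) :
    P.arrival u v ≤ P.arrival u v' ∧ P.net.ident v ≤ P.net.ident v' :=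
  (hi.2.2.2 _ (hc u v v' hm hm' ha ha') rfl).2 (ident_mem_nbrIds.2 hadj)

variable (P) in
/-- In round `t`, the node `v` invites its neighbor `w` to the cluster of `u`. -/
def Invitation (R : V → Set Report) (t : ℕ) (u v w : V) : Prop :=
  t % P.phase = 0 ∧ P.Member u v ∧ P.arrival u v + 1 = t / P.phase ∧ P.net.graph.Adj v w ∧
    Invites (R v) (t / P.phase) (P.report u v) (P.net.ident w)

namespace Evolves

variable {R : ℕ → V → Set Report} (hR : P.Evolves R) {t : ℕ}
include hR

theorem sound_and_complete_of_mod_eq_zero (ht : t < P.rounds) (hslot : t % P.phase = 0) :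
    P.Sound (R t) (t / P.phase) ∧ P.Complete (R t) (t / P.phase) := by
  have hsc := hR.sound_and_complete (div_phase_lt ht).le
  rwa [Nat.div_mul_cancel (Nat.dvd_of_mod_eq_zero hslot)] at hsc

theorem exists_sound (ht : t < P.rounds) : ∃ k, P.Sound (R t) k := by
  by_cases hslot : t % P.phase = 0
  · exact ⟨_, (hR.sound_and_complete_of_mod_eq_zero ht hslot).1⟩
  · have hk : t / P.phase ≤ P.horizon := Nat.lt_succ_iff.1 (div_phase_lt ht)
    have hlt : t % P.phase < P.phase := Nat.mod_lt t (Nat.succ_pos _)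
    obtain ⟨hs, hc⟩ := hR.sound_and_complete (hk.trans (Nat.le_succ _))
    have hsound := hR.sound_slot hk (hR.sound_first_slot hk hs hc)
      (j := t % P.phase - 1) (by omega)
    rw [Nat.sub_add_cancel (Nat.pos_of_ne_zero hslot), Nat.div_add_mod'] at hsound
    exact ⟨_, hsound⟩

theorem exists_member_of_parent_eq_some {x : V} {f : Report} (ht : t < P.rounds) (hf : f ∈ R t x)
    {v w : V} (hnode : f.node = P.net.ident v) (hpar : f.parent = some (P.net.ident w)) :
    ∃ u, P.Member u v ∧ P.par u v = w ∧ f.depth = P.hop u v := by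
  obtain ⟨k, hs⟩ := hR.exists_sound ht
  obtain ⟨u, v', hm, -, rfl⟩ := hs x f hf
  obtain rfl : v' = v := P.net.ident.injective hnode
  exact ⟨u, hm, P.net.ident.injective (parent_report.1 hpar).2, rfl⟩

theorem invitation_unique {t' : ℕ} {u v v' w : V} (ht : t < P.rounds) (ht' : t' < P.rounds)
    (h : P.Invitation (R t) t u v w) (h' : P.Invitation (R t') t' u v' w) : t = t' ∧ v = v' := by
  obtain ⟨hslot, hm, ha, hadj, hi⟩ := h
  obtain ⟨hslot', hm', ha', hadj', hi'⟩ := h'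
  have hc := (hR.sound_and_complete_of_mod_eq_zero ht hslot).2
  have hc' := (hR.sound_and_complete_of_mod_eq_zero ht' hslot').2
  have hphase : t / P.phase = t' / P.phase := by
    rcases lt_trichotomy (t / P.phase) (t' / P.phase) with hlt | heq | hlt
    · have := (hc'.le_of_invites hi' hm' hm (by omega) (by omega) hadj).1
      omega
    · exact heq
    · have := (hc.le_of_invites hi hm hm' (by omega) (by omega) hadj').1
      omega
  have hle := (hc.le_of_invites hi hm hm' (by omega) (by omega) hadj').2
  have hle' := (hc'.le_of_invites hi' hm' hm (by omega) (by omega) hadj).2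
  refine ⟨?_, P.net.ident.injective (hle.antisymm hle')⟩
  rw [← Nat.div_add_mod t P.phase, ← Nat.div_add_mod t' P.phase, hphase, hslot, hslot']

open Classical in
theorem card_invitations_le :
    (P.events fun t v w => t % P.phase = 0 ∧ ∃ f,
        Invites (R t v) (t / P.phase) f (P.net.ident w) ∧ f.node = P.net.ident v).card ≤
      Finset.card {p : V × V | P.AlmostMember p.1 p.2} := by
  refine Finset.card_le_card_of_forall_subsingleton
    (fun p e => e.2 = p.2.2 ∧ P.Invitation (R p.1) p.1 e.1 p.2.1 p.2.2) ?_ ?_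
  · rintro ⟨t, v, w⟩ h
    obtain ⟨ht, hslot, f, hi, hf⟩ := mem_events_iff.1 h
    obtain ⟨u, hm, ha, hadj, rfl⟩ :=
      (hR.sound_and_complete_of_mod_eq_zero ht hslot).1.exists_of_invites hf hi
    exact ⟨(u, w), by simpa using hm.almostMember_of_adj hadj, rfl, hslot, hm, ha, hadj, hi⟩
  · rintro ⟨u, w⟩ - ⟨t, v, _⟩ ⟨ht, rfl, h⟩ ⟨t', v', _⟩ ⟨ht', rfl, h'⟩
    obtain ⟨rfl, rfl⟩ :=
      hR.invitation_unique (mem_events_iff.1 ht).1 (mem_events_iff.1 ht').1 h h'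
    rfl

open Classical in
theorem card_upcasts_le :
    (P.events fun t v w => Upcasts (R t v) P.horizon (t % P.phase) (P.net.ident v)
        (P.net.ident w)).card ≤
      (P.horizon + 1) * Finset.card {p : V × V | P.AlmostMember p.1 p.2} := by
  rw [← Finset.card_range (P.horizon + 1), ← Finset.card_product]
  refine le_trans (Finset.card_le_card ?_) (Finset.card_image_le (f := fun e : ℕ × V × V =>
    (P.phase * e.1 + (P.horizon + 1 - P.hop e.2.1 e.2.2), e.2.2, P.par e.2.1 e.2.2)))
  rintro ⟨t, v, w⟩ h
  obtain ⟨ht, f, hf, hnode, hpar, hdepth⟩ := mem_events_iff.1 h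
  obtain ⟨u, hm, rfl, hhop⟩ := hR.exists_member_of_parent_eq_some ht hf hnode hpar
  have hslot : P.horizon + 1 - P.hop u v = t % P.phase := by omega
  refine Finset.mem_image.2 ⟨(t / P.phase, u, v), ?_, ?_⟩
  · simpa [div_phase_lt ht] using hm.almostMember
  · rw [hslot, Nat.div_add_mod]

open Classical in
theorem card_downcasts_le :
    (P.events fun t v w => Downcasts (R t v) P.horizon (t % P.phase) (P.net.ident v)
        (P.net.ident w)).card ≤
      (P.horizon + 1) * Finset.card {p : V × V | P.AlmostMember p.1 p.2} := by
  rw [← Finset.card_range (P.horizon + 1), ← Finset.card_product]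
  refine le_trans (Finset.card_le_card ?_) (Finset.card_image_le (f := fun e : ℕ × V × V =>
    (P.phase * e.1 + (P.horizon + P.hop e.2.1 e.2.2), P.par e.2.1 e.2.2, e.2.2)))
  rintro ⟨t, v, w⟩ h
  obtain ⟨ht, f, hf, hnode, hpar, hslot⟩ := mem_events_iff.1 h
  obtain ⟨u, hm, rfl, hhop⟩ := hR.exists_member_of_parent_eq_some ht hf hnode hpar
  refine Finset.mem_image.2 ⟨(t / P.phase, u, w), ?_, ?_⟩
  · simpa [div_phase_lt ht] using hm.almostMember
  · rw [← hhop, ← hslot, Nat.div_add_mod]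

theorem card_sends_le {B : ℕ} (hB : P.IsSparse B) :
    (P.events fun t v w => P.Sends (R t) t v w).card ≤
      (2 * P.horizon + 3) * (B * Fintype.card V) := by
  classical
  have hcasts := (card_events_or_le _ _).trans (Nat.add_le_add hR.card_upcasts_le
    hR.card_downcasts_le)
  calc _ ≤ _ := card_events_or_le _ _
    _ ≤ _ := Nat.add_le_add hR.card_invitations_le hcasts
    _ = (2 * P.horizon + 3) * Finset.card {p : V × V | P.AlmostMember p.1 p.2} := by ring
    _ ≤ _ := Nat.mul_le_mul_left _ hB.card_almostMember_le

end Evolves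
end Wave

namespace Schedule

variable {V : Type u} [Fintype V] {S : Schedule} {N : Network V} {κ W : ℕ} {ω : V → I}

theorem messages_le {B : ℕ} (hB : (S.wave N κ W ω).IsSparse B) :
    S.algorithm.messages N κ W ω (S.wave N κ W ω).rounds ≤
      (2 * (S.wave N κ W ω).horizon + 3) * (B * Fintype.card V) := by
  classical
  refine le_trans ?_ ((S.evolves_known N κ W ω).card_sends_le hB)
  rw [Wave.events, Finset.card_filter, Finset.sum_product]
  refine Finset.sum_le_sum fun t ht => ?_
  rw [← Finset.card_filter]
  refine Finset.card_le_card fun p hp => ?_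
  obtain ⟨-, -, hemit⟩ := Finset.mem_filter.1 hp
  obtain ⟨m, hm⟩ := Option.isSome_iff_exists.1 hemit
  exact Finset.mem_filter.2
    ⟨Finset.mem_univ p, ((emit_eq_some_iff (Finset.mem_range.1 ht)).1 hm).1⟩

end Schedule

/-! ### Waves with random delays -/

section RandomDelays

variable {V : Type u}

/-- The waves whose delays are `cap` minus a truncated geometric random variable with ratio `q`,
computed from the seeds `ω`. -/
def geometricWave (N : Network V) (q : ℝ) (cap slack : ℕ) (ω : V → I) : Wave V where
  net := N
  delay u := cap - geomShift q cap (ω u)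
  cap := cap
  slack := slack
  delay_le _ := Nat.sub_le _ _

/-- The number of steps from `u` to `w` that the waves need, whatever their delays are. -/
def waveHop (N : Network V) (cap slack : ℕ) (u w : V) : ℕ :=
  distOr N.graph (cap + slack + 1) u w

variable {N : Network V} {q : ℝ} {cap slack : ℕ} {ω : V → I}

theorem arrival_geometricWave_add (u w : V) : (geometricWave N q cap slack ω).arrival u w +
    geomShift q cap (ω u) = cap + waveHop N cap slack u w :=
  (Nat.add_right_comm _ _ _).trans
    (congrArg (· + waveHop N cap slack u w) (Nat.sub_add_cancel (geomShift_le q cap (ω u))))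

theorem arrival_geometricWave_le_iff (hq0 : 0 ≤ q) (hq1 : q ≤ 1) {u w : V} {b : ℕ}
    (hω : q ^ cap < ω u) : (geometricWave N q cap slack ω).arrival u w ≤ b ↔
      (ω u : ℝ) ≤ q ^ (cap + waveHop N cap slack u w - b) := by
  have hadd := arrival_geometricWave_add (N := N) (q := q) (cap := cap) (slack := slack)
    (ω := ω) u w
  rw [← le_geomShift_iff hq0 hq1 (ω u).2.2 hω]
  omega

theorem lt_of_le_arrival_geometricWave (hq0 : 0 ≤ q) (hq1 : q ≤ 1) {u w : V} {a : ℕ}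
    (hω : q ^ cap < ω u) (ha : a ≤ (geometricWave N q cap slack ω).arrival u w) :
    q ^ (cap + waveHop N cap slack u w + 1 - a) < ω u := by
  have hadd := arrival_geometricWave_add (N := N) (q := q) (cap := cap) (slack := slack)
    (ω := ω) u w
  rw [← not_le, ← le_geomShift_iff hq0 hq1 (ω u).2.2 hω]
  omega

theorem setOf_not_isSparse_geometricWave_subset (B : ℕ) :
    {ω : V → I | ¬ (geometricWave N q cap slack ω).IsSparse B} ⊆
      (⋃ u, {ω | (ω u : ℝ) ≤ q ^ cap}) ∪ ⋃ w, ⋃ a ∈ Finset.range (cap + 1),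
        {ω | (∀ u, q ^ cap < ω u) ∧
          B ≤ {u | (geometricWave N q cap slack ω).arrival u w ≤ a + (slack + 2)}.ncard ∧
          ∀ u, a ≤ (geometricWave N q cap slack ω).arrival u w} := by
  intro ω hω
  by_cases hseed : ∃ u, (ω u : ℝ) ≤ q ^ cap
  · exact .inl (Set.mem_iUnion.2 hseed)
  · obtain ⟨w, hw⟩ := not_forall.1 hω
    push Not at hseed
    refine .inr (Set.mem_iUnion.2 ⟨w, Set.mem_biUnion (x := Wave.firstArrival _ w) ?_
      ⟨hseed, (not_le.1 hw).le, fun u => Wave.firstArrival_le u w⟩⟩)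
    exact Finset.mem_coe.2 (Finset.mem_range.2 (Nat.lt_succ_of_le Wave.firstArrival_le_cap))

variable [Fintype V]

theorem volume_many_arrivals_le (hq0 : 0 ≤ q) (hq1 : q ≤ 1) (w : V) (a s k : ℕ) :
    (volume : Measure (V → I)) {ω | (∀ u, q ^ cap < ω u) ∧
      k ≤ {u | (geometricWave N q cap slack ω).arrival u w ≤ a + s}.ncard ∧
      ∀ u, a ≤ (geometricWave N q cap slack ω).arrival u w} ≤
      ENNReal.ofReal (1 - q ^ (s + 1)) ^ k := by
  refine (measure_mono ?_).trans
    (volume_many_le_none_le hq0 hq1 (fun u => cap + waveHop N cap slack u w) a s k)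
  rintro ω ⟨hω, hk, ha⟩
  simp only [arrival_geometricWave_le_iff hq0 hq1 (hω _)] at hk
  exact ⟨hk, fun u => lt_of_le_arrival_geometricWave hq0 hq1 (hω u) (ha u)⟩

theorem volume_not_isSparse_geometricWave_le (hq0 : 0 ≤ q) (hq1 : q ≤ 1) (B : ℕ) :
    (volume : Measure (V → I)) {ω | ¬ (geometricWave N q cap slack ω).IsSparse B} ≤
      ENNReal.ofReal (Fintype.card V * q ^ cap +
        Fintype.card V * ((cap + 1 : ℕ) * (1 - q ^ (slack + 3)) ^ B)) := by
  have hfail : 0 ≤ 1 - q ^ (slack + 3) := sub_nonneg.2 (pow_le_one₀ hq0 hq1)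
  refine (measure_mono (setOf_not_isSparse_geometricWave_subset B)).trans
    ((measure_union_le _ _).trans ?_)
  rw [ENNReal.ofReal_add (by positivity) (by positivity), ENNReal.ofReal_mul (by positivity),
    ENNReal.ofReal_mul (by positivity), ENNReal.ofReal_mul (by positivity),
    ENNReal.ofReal_natCast, ENNReal.ofReal_natCast, ENNReal.ofReal_pow hfail]
  refine add_le_add ?_ ?_
  · calc (volume : Measure (V → I)) (⋃ u, {ω | (ω u : ℝ) ≤ q ^ cap})
        ≤ ∑ u : V, (volume : Measure (V → I)) {ω | (ω u : ℝ) ≤ q ^ cap} :=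
          measure_iUnion_fintype_le _ _
      _ = ∑ _u : V, ENNReal.ofReal (q ^ cap) := Finset.sum_congr rfl fun u _ =>
          volume_setOf_apply_le u ⟨q ^ cap, pow_nonneg hq0 _, pow_le_one₀ hq0 hq1⟩
      _ = Fintype.card V * ENNReal.ofReal (q ^ cap) := by
          rw [Finset.sum_const, Finset.card_univ, nsmul_eq_mul]
  · refine (measure_iUnion_fintype_le _ _).trans ((Finset.sum_le_sum fun w _ =>
      (measure_biUnion_finset_le _ _).trans (Finset.sum_le_sum fun a _ =>
        volume_many_arrivals_le hq0 hq1 w a (slack + 2) B)).trans_eq ?_)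
    simp only [Finset.sum_const, Finset.card_univ, Finset.card_range, nsmul_eq_mul]

end RandomDelays

/-! ### The choice of the parameters -/

/-- The number of steps in which the tail of the distribution of the delays decreases by the factor
`n`. -/
def waveScale (n κ W : ℕ) : ℕ := 5 * (min κ n * min W n)

/-- The largest delay. -/
def waveCap (c n κ W : ℕ) : ℕ := waveScale n κ W * (c + 2)

/-- The ratio of the geometric distribution of the delays. -/
def waveRatio (n κ W : ℕ) : ℝ := (n : ℝ) ^ (-(1 / (waveScale n κ W : ℝ)))

/-- The bound for the number of waves that arrive at a node soon after the first one. -/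
def waveBound (c n κ : ℕ) : ℕ :=
  ⌈(2 * c + 8) * Real.log n * (2 * (n : ℝ) ^ (1 / (κ : ℝ)))⌉₊

section Parameters

variable {n κ W : ℕ}

theorem waveScale_pos (hn : 0 < n) (hκ : 1 ≤ κ) (hW : 1 ≤ W) : 0 < waveScale n κ W :=
  Nat.mul_pos (by norm_num) (Nat.mul_pos (lt_min hκ hn) (lt_min hW hn))

theorem waveRatio_nonneg : 0 ≤ waveRatio n κ W := Real.rpow_nonneg n.cast_nonneg _

theorem waveRatio_le_one : waveRatio n κ W ≤ 1 := by
  rcases n.eq_zero_or_pos with rfl | hn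
  · rw [waveRatio, Nat.cast_zero]
    exact Real.zero_rpow_le_one _
  · exact Real.rpow_le_one_of_one_le_of_nonpos (mod_cast hn) (neg_nonpos.2 (by positivity))

theorem waveRatio_pow_waveScale (hn : 0 < n) (hκ : 1 ≤ κ) (hW : 1 ≤ W) :
    waveRatio n κ W ^ waveScale n κ W = (n : ℝ)⁻¹ := by
  have hscale : (waveScale n κ W : ℝ) ≠ 0 := mod_cast (waveScale_pos hn hκ hW).ne'
  rw [waveRatio, ← Real.rpow_natCast, ← Real.rpow_mul n.cast_nonneg, neg_mul,
    one_div_mul_cancel hscale, Real.rpow_neg_one]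

theorem waveRatio_pow_waveCap (c : ℕ) (hn : 0 < n) (hκ : 1 ≤ κ) (hW : 1 ≤ W) :
    waveRatio n κ W ^ waveCap c n κ W = ((n : ℝ) ^ (c + 2))⁻¹ := by
  rw [waveCap, pow_mul, waveRatio_pow_waveScale hn hκ hW, inv_pow]

theorem rpow_one_div_min_le (hn : 0 < n) :
    (n : ℝ) ^ (1 / ((min κ n : ℕ) : ℝ)) ≤ 2 * (n : ℝ) ^ (1 / (κ : ℝ)) := by
  have hn0 : (0 : ℝ) < n := mod_cast hn
  have hroot : (1 : ℝ) ≤ (n : ℝ) ^ (1 / (κ : ℝ)) := Real.one_le_rpow (mod_cast hn) (by positivity)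
  rcases le_total κ n with h | h
  · rw [min_eq_left h]
    linarith
  · have hroot_n : (n : ℝ) ^ (1 / (n : ℝ)) ≤ 2 :=
      calc (n : ℝ) ^ (1 / (n : ℝ)) ≤ ((2 : ℝ) ^ n) ^ (1 / (n : ℝ)) :=
            Real.rpow_le_rpow hn0.le (mod_cast n.lt_two_pow_self.le) (by positivity)
        _ = 2 := by rw [one_div, Real.pow_rpow_inv_natCast (by norm_num) hn.ne']
    rw [min_eq_right h]
    linarith

theorem waveRatio_pow_five_mul_min (hn : 0 < n) (hW : 1 ≤ W) :
    waveRatio n κ W ^ (5 * min W n) = ((n : ℝ) ^ (1 / ((min κ n : ℕ) : ℝ)))⁻¹ := by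
  have hmin : ((min W n : ℕ) : ℝ) ≠ 0 := mod_cast (lt_min hW hn).ne'
  rw [waveRatio, ← Real.rpow_natCast, ← Real.rpow_mul n.cast_nonneg,
    ← Real.rpow_neg n.cast_nonneg]
  congr 1
  rw [waveScale, Nat.cast_mul, Nat.cast_mul, Nat.cast_mul]
  field_simp

theorem le_waveRatio_pow (hn : 0 < n) (hW : 1 ≤ W) :
    (2 * (n : ℝ) ^ (1 / (κ : ℝ)))⁻¹ ≤ waveRatio n κ W ^ (2 * min W n + 3) := by
  have hmin : 1 ≤ min W n := le_min hW hn
  calc (2 * (n : ℝ) ^ (1 / (κ : ℝ)))⁻¹ ≤ ((n : ℝ) ^ (1 / ((min κ n : ℕ) : ℝ)))⁻¹ :=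
        inv_anti₀ (Real.rpow_pos_of_pos (mod_cast hn) _) (rpow_one_div_min_le hn)
    _ = waveRatio n κ W ^ (5 * min W n) := (waveRatio_pow_five_mul_min hn hW).symm
    _ ≤ _ := pow_le_pow_of_le_one waveRatio_nonneg waveRatio_le_one (by omega)

theorem waveCap_add_one_le (c : ℕ) (hn : 2 ≤ n) : waveCap c n κ W + 1 ≤ n ^ (c + 6) := by
  have hcap : waveCap c n κ W ≤ 5 * (n * n) * (c + 2) :=
    Nat.mul_le_mul_right _ (Nat.mul_le_mul_left _
      (Nat.mul_le_mul (min_le_right _ _) (min_le_right _ _)))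
  have hpow : 5 * c + 11 ≤ 2 ^ (c + 4) := by
    have := c.lt_two_pow_self
    rw [pow_add]
    omega
  have hsq : 1 ≤ n * n := Nat.mul_pos (by omega) (by omega)
  calc waveCap c n κ W + 1 ≤ (5 * c + 11) * (n * n) := by nlinarith
    _ ≤ n ^ (c + 4) * (n * n) :=
        Nat.mul_le_mul_right _ (hpow.trans (Nat.pow_le_pow_left hn _))
    _ = n ^ (c + 6) := by ring

theorem waveBound_le (c : ℕ) (hn : 2 ≤ n) : (waveBound c n κ : ℝ) ≤
    (4 * c + 18) * ((n : ℝ) ^ (1 / (κ : ℝ)) * Real.log n) := by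
  have hroot : (1 : ℝ) ≤ (n : ℝ) ^ (1 / (κ : ℝ)) :=
    Real.one_le_rpow (mod_cast one_le_two.trans hn) (by positivity)
  have hlog : (1 / 2 : ℝ) ≤ Real.log n := by
    have hmono : Real.log 2 ≤ Real.log n := Real.log_le_log two_pos (mod_cast hn)
    linarith [Real.log_two_gt_d9]
  have hceil : (waveBound c n κ : ℝ) ≤
      (2 * c + 8) * Real.log n * (2 * (n : ℝ) ^ (1 / (κ : ℝ))) + 1 :=
    (Nat.ceil_lt_add_one (by positivity)).le
  have hone : (1 : ℝ) ≤ 2 * ((n : ℝ) ^ (1 / (κ : ℝ)) * Real.log n) := by nlinarith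
  linarith

theorem one_sub_pow_waveBound_le (c : ℕ) (hn : 0 < n) {ρ : ℝ} (hρ1 : ρ ≤ 1)
    (hρ : (2 * (n : ℝ) ^ (1 / (κ : ℝ)))⁻¹ ≤ ρ) :
    (1 - ρ) ^ waveBound c n κ ≤ ((n : ℝ) ^ (2 * c + 8))⁻¹ := by
  have hn0 : (0 : ℝ) < n := mod_cast hn
  have hexponent : (2 * c + 8) * Real.log n ≤ ρ * waveBound c n κ :=
    calc (2 * c + 8) * Real.log n = (2 * (n : ℝ) ^ (1 / (κ : ℝ)))⁻¹ *
          ((2 * c + 8) * Real.log n * (2 * (n : ℝ) ^ (1 / (κ : ℝ)))) := by field_simp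
      _ ≤ (2 * (n : ℝ) ^ (1 / (κ : ℝ)))⁻¹ * waveBound c n κ :=
          mul_le_mul_of_nonneg_left (Nat.le_ceil _) (by positivity)
      _ ≤ ρ * waveBound c n κ := mul_le_mul_of_nonneg_right hρ (by positivity)
  calc (1 - ρ) ^ waveBound c n κ ≤ Real.exp (-ρ) ^ waveBound c n κ :=
        pow_le_pow_left₀ (sub_nonneg.2 hρ1) (Real.one_sub_le_exp_neg ρ) _
    _ = Real.exp (-(ρ * waveBound c n κ)) := by rw [← Real.exp_nat_mul]; congr 1; ring
    _ ≤ Real.exp (-((2 * c + 8) * Real.log n)) := Real.exp_le_exp.2 (neg_le_neg hexponent)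
    _ = ((n : ℝ) ^ (2 * c + 8))⁻¹ := by
        rw [Real.exp_neg, ← Real.exp_log (pow_pos hn0 (2 * c + 8)), Real.log_pow]
        push_cast
        rfl

theorem failure_probability_le (c : ℕ) (hn : 2 ≤ n) (hκ : 1 ≤ κ) (hW : 1 ≤ W) :
    n * waveRatio n κ W ^ waveCap c n κ W + n * ((waveCap c n κ W + 1 : ℕ) *
      (1 - waveRatio n κ W ^ (2 * min W n + 3)) ^ waveBound c n κ) ≤ 1 / (n : ℝ) ^ c := by
  have hn0 : 0 < n := two_pos.trans_le hn
  have hcap : ((waveCap c n κ W + 1 : ℕ) : ℝ) ≤ (n : ℝ) ^ (c + 6) :=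
    mod_cast waveCap_add_one_le c hn
  have hpow : waveRatio n κ W ^ (2 * min W n + 3) ≤ 1 :=
    pow_le_one₀ waveRatio_nonneg waveRatio_le_one
  have : 0 ≤ 1 - waveRatio n κ W ^ (2 * min W n + 3) := sub_nonneg.2 hpow
  have htail := one_sub_pow_waveBound_le c hn0 hpow (le_waveRatio_pow hn0 hW)
  rw [waveRatio_pow_waveCap c hn0 hκ hW]
  calc (n : ℝ) * ((n : ℝ) ^ (c + 2))⁻¹ + n * ((waveCap c n κ W + 1 : ℕ) * _)
      ≤ (n : ℝ) * ((n : ℝ) ^ (c + 2))⁻¹ +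
        n * ((n : ℝ) ^ (c + 6) * ((n : ℝ) ^ (2 * c + 8))⁻¹) := by gcongr
    _ = (2 / n) * (1 / (n : ℝ) ^ c) := by
        rw [show 2 * c + 8 = (c + 6) + (c + 2) by ring]
        simp only [pow_add]
        field_simp
        ring
    _ ≤ 1 / (n : ℝ) ^ c := mul_le_of_le_one_left (by positivity)
        ((div_le_one (mod_cast hn0)).2 (mod_cast hn))

end Parameters

/-- The schedule of the random delays. Since distances in a component are less than `n`, a slack of
`2 * min W n` is as good as `2 * W`. -/
def coverSchedule (c : ℕ) : Schedule where
  cap n κ W := waveCap c n κ W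
  slack n _ W := 2 * min W n
  delay a := waveCap c a.n a.κ a.W -
    geomShift (waveRatio a.n a.κ a.W) (waveCap c a.n a.κ a.W) a.seed
  delay_le _ := Nat.sub_le _ _

section Cover

variable {V : Type u} [Fintype V] (c : ℕ) (N : Network V) {κ W : ℕ}

theorem wave_coverSchedule (ω : V → I) : (coverSchedule c).wave N κ W ω =
    geometricWave N (waveRatio (Fintype.card V) κ W) (waveCap c (Fintype.card V) κ W)
      (2 * min W (Fintype.card V)) ω :=
  rfl

theorem volume_not_isSparse_le (hκ : 1 ≤ κ) (hW : 1 ≤ W) (hn : 2 ≤ Fintype.card V) :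
    (volume : Measure (V → I)) {ω | ¬ ((coverSchedule c).wave N κ W ω).IsSparse
      (waveBound c (Fintype.card V) κ)} ≤ 1 / (Fintype.card V : ℝ≥0∞) ^ c := by
  simp only [wave_coverSchedule]
  calc _ ≤ _ := volume_not_isSparse_geometricWave_le waveRatio_nonneg waveRatio_le_one _
    _ ≤ ENNReal.ofReal (1 / (Fintype.card V : ℝ) ^ c) :=
        ENNReal.ofReal_le_ofReal (failure_probability_le c hn hκ hW)
    _ = _ := by
        rw [ENNReal.ofReal_div_of_pos (by positivity), ENNReal.ofReal_one,
          ENNReal.ofReal_pow (Nat.cast_nonneg _), ENNReal.ofReal_natCast]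

end Cover

/-! ### The bounds -/

theorem edist_le_min_card {V : Type u} [Fintype V] (G : SimpleGraph V) {v w : V} {W : ℕ}
    (h : G.edist v w ≤ W) : G.edist v w ≤ (min W (Fintype.card V) : ℕ) := by
  classical
  obtain ⟨p, hp⟩ := (SimpleGraph.edist_ne_top_iff_reachable.1
    (h.trans_lt (ENat.natCast_lt_top W)).ne).exists_isPath
  rcases min_choice W (Fintype.card V) with hmin | hmin <;> rw [hmin]
  · exact h
  · exact (SimpleGraph.edist_le p).trans (mod_cast hp.length_lt.le)

/-- The constant in all the bounds of the theorem. -/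
def coverConst (c : ℕ) : ℝ := 6 * (5 * c + 12) ^ 2 * (4 * c + 18)

theorem coverConst_pos (c : ℕ) : 0 < coverConst c := by
  unfold coverConst
  positivity

/-- The horizon of the waves with random delays in networks with `n` nodes. -/
def coverHorizon (c n κ W : ℕ) : ℕ := waveCap c n κ W + 2 * min W n

theorem coverHorizon_le (c n : ℕ) {κ : ℕ} (hκ : 1 ≤ κ) (W : ℕ) :
    (coverHorizon c n κ W : ℝ) ≤ (5 * c + 12) * (κ * W) := by
  have hscale : waveScale n κ W ≤ 5 * (κ * W) :=
    Nat.mul_le_mul_left _ (Nat.mul_le_mul (min_le_left _ _) (min_le_left _ _))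
  have hslack : min W n ≤ κ * W := (min_le_left _ _).trans (Nat.le_mul_of_pos_left _ hκ)
  have hle : coverHorizon c n κ W ≤ 5 * (κ * W) * (c + 2) + 2 * (κ * W) :=
    add_le_add (Nat.mul_le_mul_right _ hscale) (Nat.mul_le_mul_left _ hslack)
  calc (coverHorizon c n κ W : ℝ) ≤ ((5 * (κ * W) * (c + 2) + 2 * (κ * W) : ℕ) : ℝ) :=
        mod_cast hle
    _ = _ := by push_cast; ring

theorem roundCount_coverHorizon_le (c n : ℕ) {κ W : ℕ} (hκ : 1 ≤ κ) (hW : 1 ≤ W) :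
    (roundCount (coverHorizon c n κ W) : ℝ) ≤ coverConst c * ((κ : ℝ) ^ 3 * (W : ℝ) ^ 2) := by
  have hκ1 : (1 : ℝ) ≤ κ := mod_cast hκ
  have hκW : (1 : ℝ) ≤ κ * W := mod_cast Nat.mul_pos hκ hW
  have hH := coverHorizon_le c n hκ W
  set H := coverHorizon c n κ W
  set x : ℝ := (5 * c + 12) * (κ * W) with hx
  have hx1 : 1 ≤ x := by nlinarith [(Nat.cast_nonneg c : (0 : ℝ) ≤ c)]
  calc (roundCount H : ℝ) = ((H : ℝ) + 1) * (2 * H + 1) := by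
        rw [roundCount, phaseLength]
        push_cast
        ring
    _ ≤ (2 * x) * (3 * x) := by gcongr <;> linarith
    _ = 6 * (5 * c + 12) ^ 2 * 1 * (κ ^ 2 * 1 * W ^ 2) := by rw [hx]; ring
    _ ≤ 6 * (5 * c + 12) ^ 2 * (4 * c + 18) * (κ ^ 2 * κ * W ^ 2) := by
        gcongr
        linarith
    _ = _ := by rw [coverConst]; ring

theorem coverHorizon_le_coverConst (c n : ℕ) {κ : ℕ} (hκ : 1 ≤ κ) (W : ℕ) :
    (coverHorizon c n κ W : ℝ) ≤ coverConst c * (W * κ) := by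
  have hconst : (5 * c + 12 : ℝ) ≤ coverConst c := by
    rw [coverConst]
    nlinarith [(Nat.cast_nonneg c : (0 : ℝ) ≤ c)]
  calc (coverHorizon c n κ W : ℝ) ≤ (5 * c + 12) * (κ * W) := coverHorizon_le c n hκ W
    _ ≤ coverConst c * (κ * W) := by gcongr
    _ = coverConst c * (W * κ) := by rw [mul_comm (W : ℝ)]

theorem waveBound_le_coverConst (c : ℕ) {n κ : ℕ} (hn : 2 ≤ n) (hκ : 1 ≤ κ) :
    (waveBound c n κ : ℝ) ≤ coverConst c * (κ * (n : ℝ) ^ (1 / (κ : ℝ)) * Real.log n) := by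
  have hκ1 : (1 : ℝ) ≤ κ := mod_cast hκ
  have : 0 ≤ Real.log n := Real.log_natCast_nonneg n
  have hconst : (4 * c + 18 : ℝ) ≤ coverConst c := by
    rw [coverConst]
    nlinarith [(Nat.cast_nonneg c : (0 : ℝ) ≤ c), sq_nonneg (c : ℝ)]
  calc (waveBound c n κ : ℝ) ≤ (4 * c + 18) * ((n : ℝ) ^ (1 / (κ : ℝ)) * Real.log n) :=
        waveBound_le c hn
    _ ≤ coverConst c * (κ * ((n : ℝ) ^ (1 / (κ : ℝ)) * Real.log n)) :=
        mul_le_mul hconst (le_mul_of_one_le_left (by positivity) hκ1) (by positivity)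
          (coverConst_pos c).le
    _ = _ := by rw [mul_assoc (κ : ℝ)]

section Cover

variable {V : Type u} [Fintype V] {c κ W : ℕ} {N : Network V} {ω : V → I}

theorem terminatesBy_coverHorizon (ω : V → I) : (coverSchedule c).algorithm.TerminatesBy N κ W ω
    (roundCount (coverHorizon c (Fintype.card V) κ W)) := fun _ =>
  Option.isSome_iff_exists.2 ⟨_, Schedule.output_run⟩

theorem constructsCover_of_isSparse (hκ : 1 ≤ κ) (hn : 2 ≤ Fintype.card V)
    (h : ((coverSchedule c).wave N κ W ω).IsSparse (waveBound c (Fintype.card V) κ)) :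
    (coverSchedule c).algorithm.ConstructsCover N (coverConst c) κ W ω
      (roundCount (coverHorizon c (Fintype.card V) κ W)) :=
  ⟨_, _, _, fun _ => Schedule.output_run, ((coverSchedule c).evolves_known N κ W ω).represents,
    Wave.isSparseNeighborhoodCover_clusterOf (fun _ _ => edist_le_min_card N.graph) le_rfl
      (coverHorizon_le_coverConst c _ hκ W) h (waveBound_le_coverConst c hn hκ)⟩

theorem messages_le_of_isSparse (hκ : 1 ≤ κ) (hW : 1 ≤ W) (hn : 2 ≤ Fintype.card V)
    (h : ((coverSchedule c).wave N κ W ω).IsSparse (waveBound c (Fintype.card V) κ)) :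
    ((coverSchedule c).algorithm.messages N κ W ω
      (roundCount (coverHorizon c (Fintype.card V) κ W)) : ℝ) ≤
        coverConst c * (Fintype.card V * κ * (Fintype.card V : ℝ) ^ (1 / (κ : ℝ)) *
          Real.log (Fintype.card V) * (κ * W)) := by
  have hmessages := Schedule.messages_le h
  have hB := waveBound_le (κ := κ) c hn
  have hH := coverHorizon_le c (Fintype.card V) hκ W
  have hlog : 0 ≤ Real.log (Fintype.card V) := Real.log_natCast_nonneg _
  have hκ1 : (1 : ℝ) ≤ κ := mod_cast hκ
  have hκW : (1 : ℝ) ≤ κ * W := mod_cast Nat.mul_pos hκ hW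
  set n := Fintype.card V
  set H := coverHorizon c n κ W
  set L : ℝ := (n : ℝ) ^ (1 / (κ : ℝ)) * Real.log n with hL
  set x : ℝ := (5 * c + 12) * (κ * W) with hx
  have hx1 : 1 ≤ x := by nlinarith [(Nat.cast_nonneg c : (0 : ℝ) ≤ c)]
  calc ((coverSchedule c).algorithm.messages N κ W ω (roundCount H) : ℝ)
      ≤ (((2 * H + 3) * (waveBound c n κ * n) : ℕ) : ℝ) := mod_cast hmessages
    _ = (2 * (H : ℝ) + 3) * (waveBound c n κ * n) := by push_cast; ring
    _ ≤ (5 * x) * ((4 * c + 18) * L * n) := by gcongr; linarith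
    _ = (5 * (5 * c + 12) * (4 * c + 18)) * (n * 1 * L * (κ * W)) := by rw [hx]; ring
    _ ≤ (6 * (5 * c + 12) ^ 2 * (4 * c + 18)) * (n * κ * L * (κ * W)) := by
        gcongr
        · norm_num
        · nlinarith
    _ = _ := by rw [hL, coverConst]; ring

end Cover

end

theorem mainTheorem3 (c : ℕ) :
    ∃ (A : DistAlgorithm) (C : ℝ), 0 < C ∧
      ∀ (κ W : ℕ), 1 ≤ κ → 1 ≤ W →
      ∀ (V : Type u) [Fintype V] (N : Network V), 2 ≤ Fintype.card V →
      ∃ T : ℕ, (T : ℝ) ≤ C * ((κ : ℝ) ^ 3 * (W : ℝ) ^ 2) ∧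
        (∀ ω : V → I, A.TerminatesBy N κ W ω T) ∧
        (volume : Measure (V → I))
          {ω | ¬ (A.ConstructsCover N C κ W ω T ∧
            (A.messages N κ W ω T : ℝ) ≤
              C * (Fintype.card V * κ * (Fintype.card V : ℝ) ^ (1 / (κ : ℝ)) *
                Real.log (Fintype.card V) * (κ * W)))} ≤
          1 / (Fintype.card V : ℝ≥0∞) ^ c := by
  refine ⟨(coverSchedule c).algorithm, coverConst c, coverConst_pos c, fun κ W hκ hW V _ N hn =>
    ⟨roundCount (coverHorizon c (Fintype.card V) κ W), roundCount_coverHorizon_le c _ hκ hW,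
      terminatesBy_coverHorizon, ?_⟩⟩
  refine le_trans (measure_mono ?_) (volume_not_isSparse_le c N hκ hW hn)
  intro ω hfail hsparse
  exact hfail ⟨constructsCover_of_isSparse hκ hn hsparse,
    messages_le_of_isSparse hκ hW hn hsparse⟩
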